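/- Let $G,H$ be (real, finite-dimensional, smooth) Lie groups and $\Phi:G\to H$ a smooth homomorphism. Let $V,W$ be finite-dimensional real vector spaces with Lie group homomorphisms $\varrho_V:G\to\mathrm{Aut}(V)$, $\varrho_W:H\to\mathrm{Aut}(W)$, and let $\psi:V\to W$ be linear with $\psi(\varrho_V(g)v)=\varrho_W(\Phi(g))\psi(v)$ for all $g\in G$, $v\in V$. Write $\mathfrak g=\mathrm{Lie}(G)$, $\mathfrak h=\mathrm{Lie}(H)$ (tangent spaces at $1$, with the bracket of left invariant vector fields), $\phi=\mathrm{Lie}(\Phi)=T_1\Phi$, and let $\rho_V=T_1\varrho_V$, $\rho_W=T_1\varrho_W$ be the induced representations of $\mathfrak g$, $\mathfrak h$, so that $\rho_V(X)v=\frac{d}{dt}|_{t=0}\varrho_V(\exp tX)v$. The group $G$ acts on $W$ by $\varrho_W\circ\Phi$, and $\mathfrak g$ acts on $W$ by $\rho_W\circ\phi$. *Group side.* For a $G$-module $V$ let $C^n_d(G,V)$ be the space of smooth maps $f:G^n\to V$ with $f(g_1,\dots,g_n)=0$ as soon as some $g_i=1$, and let $$(\delta f)(g_1,\dots,g_{n+1})=g_1f(g_2,\dots,g_{n+1})+\sum_{i=1}^n(-1)^if(\dots,g_ig_{i+1},\dots)+(-1)^{n+1}f(g_1,\dots,g_n).$$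 Put $C^0_{\mathsf{mLG},d}=V$ and $C^n_{\mathsf{mLG},d}=C^n_d(G,V)\oplus C^n_d(H,W)\oplus C^{n-1}_d(G,W)$ for $n\ge1$, with $$\delta_{\mathsf{mLG}}(v)=(\delta v,\delta(\psi v),0),\qquad \delta_{\mathsf{mLG}}(\Theta,\Gamma,\Lambda)=(\delta\Theta,\ \delta\Gamma,\ \psi\circ\Theta-\Gamma\circ\Phi^{\times n}-\delta\Lambda).$$ *Lie algebra side.* For a representation $\rho$ of $\mathfrak g$ on $V$ let $C^n_{\mathsf{CE}}(\mathfrak g,V)=\mathrm{Hom}(\wedge^n\mathfrak g,V)$ with $$(\delta f)(x_1,\dots,x_{n+1})=\sum_i(-1)^{i+1}\rho(x_i)f(\dots,\widehat{x_i},\dots)+\sum_{i<j}(-1)^{i+j}f([x_i,x_j],\dots,\widehat{x_i},\dots,\widehat{x_j},\dots).$$ Put $C^0_{\mathsf{mLA}}=V$ and $C^n_{\mathsf{mLA}}=C^n_{\mathsf{CE}}(\mathfrak g,V)\oplus C^n_{\mathsf{CE}}(\mathfrak h,W)\oplus C^{n-1}_{\mathsf{CE}}(\mathfrak g,W)$ for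 $n\ge1$, with $$\delta_{\mathsf{mLA}}(v)=(\delta v,\delta(\psi v),0),\qquad \delta_{\mathsf{mLA}}(\theta,\gamma,\eta)=(\delta\theta,\ \delta\gamma,\ \psi\circ\theta-\gamma\circ\wedge^n\phi-\delta\eta).$$ *Van Est map.* For $f\in C^n_d(G,V)$ and $X_1,\dots,X_n\in\mathfrak g$ let $$\mathrm{vE}(f)(X_1,\dots,X_n)=\sum_{\sigma\in S_n}\mathrm{sgn}(\sigma)\,D_{X_{\sigma(1)},\dots,X_{\sigma(n)}}f,$$ where $D_{Y_1,\dots,Y_n}f$ is the iterated derivative of $f$ at $(1,\dots,1)$, in the direction $Y_1$ in the first variable, then $Y_2$ in the second variable, and so on; for $n=0$, $\mathrm{vE}$ is the identity of $V$. Put $\mathrm{vE}(v)=v$ for $v\in C^0_{\mathsf{mLG},d}$ and $\mathrm{vE}(\Theta,\Gamma,\Lambda)=(\mathrm{vE}\,\Theta,\mathrm{vE}\,\Gamma,\mathrm{vE}\,\Lambda)$ in degrees $n\ge1$. **Theorem.** The triple $(V,W,\psi)$ is a representation of the morphism Lie algebra $(\mathfrak g,\mathfrak h,\phi)$, that is,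 also $\psi(\rho_V(X)v)=\rho_W(\phi(X))\psi(v)$. Both $(C^*_{\mathsf{mLG},d},\delta_{\mathsf{mLG}})$ and $(C^*_{\mathsf{mLA}},\delta_{\mathsf{mLA}})$ are cochain complexes. The maps $\mathrm{vE}:C^n_{\mathsf{mLG},d}\to C^n_{\mathsf{mLA}}$ are well defined, linear, and form a homomorphism of cochain complexes. Hence there are linear maps $H^n_{\mathsf{mLG},d}\to H^n_{\mathsf{mLA}}$, $[z]\mapsto[\mathrm{vE}(z)]$, for all $n\ge0$. -/

import Mathlib

open scoped Manifold ContDiff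

universe u

attribute [local instance] LieRing.ofAssociativeRing

noncomputable section

/-! ### Cochain complexes of functions, and their cohomology -/

section Cohomology

variable {A A' : ℕ → Type u} [∀ n, AddCommGroup (A n)] [∀ n, Module ℝ (A n)]
  [∀ n, AddCommGroup (A' n)] [∀ n, Module ℝ (A' n)]

/-- The subspaces `C n` of the spaces `A n` form a cochain complex for the maps `d`. -/
structure IsCochainComplex (C : ∀ n, Submodule ℝ (A n)) (d : ∀ n, A n →ₗ[ℝ] A (n + 1)) : Prop where
  map_mem : ∀ n, ∀ c ∈ C n, d n c ∈ C (n + 1)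
  d_comp_d : ∀ n, ∀ c ∈ C n, d (n + 1) (d n c) = 0

/-- The `n`-cocycles of the complex `(C, d)`. -/
def cocycles (C : ∀ n, Submodule ℝ (A n)) (d : ∀ n, A n →ₗ[ℝ] A (n + 1)) (n : ℕ) :
    Submodule ℝ (A n) :=
  C n ⊓ LinearMap.ker (d n)

/-- The `n`-coboundaries of the complex `(C, d)`. -/
def coboundaries (C : ∀ n, Submodule ℝ (A n)) (d : ∀ n, A n →ₗ[ℝ] A (n + 1)) :
    ∀ n, Submodule ℝ (A n)
  | 0 => ⊥
  | n + 1 => (C n).map (d n)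

/-- The `n`-th cohomology space of the complex `(C, d)`: cocycles modulo coboundaries. -/
abbrev Cohomology (C : ∀ n, Submodule ℝ (A n)) (d : ∀ n, A n →ₗ[ℝ] A (n + 1)) (n : ℕ) : Type u :=
  cocycles C d n ⧸ (coboundaries C d n).submoduleOf (cocycles C d n)

/-- The cohomology class of a cocycle. -/
def cohomologyClass (C : ∀ n, Submodule ℝ (A n)) (d : ∀ n, A n →ₗ[ℝ] A (n + 1)) (n : ℕ)
    (z : cocycles C d n) : Cohomology C d n :=
  Submodule.Quotient.mk z

/-- The maps `F n` restrict to a homomorphism of cochain complexes from `(C, d)` to `(C', d')`. The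
maps `F n` only have to be linear on the subspaces `C n`. -/
structure IsCochainMap (C : ∀ n, Submodule ℝ (A n)) (d : ∀ n, A n →ₗ[ℝ] A (n + 1))
    (C' : ∀ n, Submodule ℝ (A' n)) (d' : ∀ n, A' n →ₗ[ℝ] A' (n + 1))
    (F : ∀ n, A n → A' n) : Prop where
  map_mem : ∀ n, ∀ c ∈ C n, F n c ∈ C' n
  map_add : ∀ n, ∀ c ∈ C n, ∀ e ∈ C n, F n (c + e) = F n c + F n e
  map_smul : ∀ n, ∀ r : ℝ, ∀ c ∈ C n, F n (r • c) = r • F n c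
  comm : ∀ n, ∀ c ∈ C n, F (n + 1) (d n c) = d' n (F n c)

end Cohomology

/-! ### Chevalley-Eilenberg cochains and group cochains -/

section Cochains

variable {L V : Type u} [LieRing L] [LieAlgebra ℝ L] [AddCommGroup V] [Module ℝ V]

/-- The Chevalley-Eilenberg `n`-cochains `Hom(⋀ⁿ L, V)`: the functions of `n` variables in `L` that
are multilinear and alternating. -/
def ceCochains (L V : Type u) [LieRing L] [LieAlgebra ℝ L] [AddCommGroup V] [Module ℝ V] (n : ℕ) :
    Submodule ℝ ((Fin n → L) → V) where
  carrier := {f | ∃ a : L [⋀^Fin n]→ₗ[ℝ] V, ⇑a = f}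
  add_mem' := by
    rintro _ _ ⟨a, rfl⟩ ⟨b, rfl⟩
    exact ⟨a + b, rfl⟩
  zero_mem' := ⟨0, rfl⟩
  smul_mem' := by
    rintro r _ ⟨a, rfl⟩
    exact ⟨r • a, rfl⟩

/-- The terms `f ([xᵢ, xⱼ], x₀, …, x̂ᵢ, …, x̂ⱼ, …, xₙ)` of the Chevalley-Eilenberg differential, summed
over `i < j` with the sign `(-1)^(i+j)`. There are none if `f` has no variable. -/
def ceBracketSum : ∀ n : ℕ, ((Fin n → L) → V) → (Fin (n + 1) → L) → V
  | 0, _, _ => 0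
  | n + 1, f, x => ∑ i : Fin (n + 2), ∑ j : Fin (n + 2),
      if h : i < j then
        (-1 : ℝ) ^ ((i : ℕ) + (j : ℕ)) •
          f (Fin.cons ⁅x i, x j⁆ ((i.castPred (Fin.ne_last_of_lt h)).removeNth (j.removeNth x)))
      else 0

/-- The Chevalley-Eilenberg differential of the Lie algebra `L` with coefficients in the
representation `ρ : L → End V`. -/
def ceDifferential (ρ : L →ₗ⁅ℝ⁆ Module.End ℝ V) (n : ℕ) :
    ((Fin n → L) → V) →ₗ[ℝ] ((Fin (n + 1) → L) → V) where
  toFun f x := ∑ i : Fin (n + 1), (-1 : ℝ) ^ (i : ℕ) • ρ (x i) (f (i.removeNth x)) +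
    ceBracketSum n f x
  map_add' f f' := by
    funext x
    cases n with
    | zero => simp [ceBracketSum, smul_add, Finset.sum_add_distrib]
    | succ n =>
      have h : ∀ (p : Prop) [Decidable p] (a b : p → V),
          (if h : p then a h + b h else 0) = (if h : p then a h else 0) + (if h : p then b h else 0) := by
        intro p _ a b; split_ifs <;> simp
      simp only [ceBracketSum, Pi.add_apply, map_add, smul_add, h, Finset.sum_add_distrib]
      abel
  map_smul' r f := by
    funext x
    cases n with
    | zero => simp [ceBracketSum]
    | succ n =>
      have h : ∀ (p : Prop) [Decidable p] (a : p → V),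
          (if h : p then r • a h else 0) = r • (if h : p then a h else 0) := by
        intro p _ a; split_ifs <;> simp
      simp only [ceBracketSum, Pi.smul_apply, map_smul, smul_add, Finset.smul_sum, RingHom.id_apply,
        ← h, smul_comm r]

/-- The coboundary operator of the group `G` with coefficients in the `G`-module `V`, on all
functions `Gⁿ → V`. -/
def groupDifferential {G : Type u} [Group G] (ρ : Representation ℝ G V) (n : ℕ) :
    ((Fin n → G) → V) →ₗ[ℝ] ((Fin (n + 1) → G) → V) where
  toFun f g := ρ (g 0) (f (Fin.tail g)) +
    ∑ i : Fin n, (-1 : ℝ) ^ ((i : ℕ) + 1) • f (Fin.contractNth i.castSucc (· * ·) g) +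
    (-1 : ℝ) ^ (n + 1) • f (Fin.init g)
  map_add' f f' := by
    funext g
    simp only [Pi.add_apply, map_add, smul_add, Finset.sum_add_distrib]
    abel
  map_smul' r f := by
    funext g
    simp only [Pi.smul_apply, map_smul, smul_add, Finset.smul_sum, RingHom.id_apply, smul_comm r]

end Cochains

/-! ### The complex of a morphism, with coefficients in a morphism -/

section MorphismCochains

variable {S T V W : Type u} [AddCommGroup V] [Module ℝ V] [AddCommGroup W] [Module ℝ W]

/-- `V` in degree `0`, and triples of functions `(Sⁿ → V, Tⁿ → W, Sⁿ⁻¹ → W)` in degree `n ≥ 1`. -/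
def MorphismCochain (S T V W : Type u) : ℕ → Type u
  | 0 => V
  | n + 1 => ((Fin (n + 1) → S) → V) × ((Fin (n + 1) → T) → W) × ((Fin n → S) → W)

instance instAddCommGroupMorphismCochain : ∀ n, AddCommGroup (MorphismCochain S T V W n)
  | 0 => inferInstanceAs (AddCommGroup V)
  | n + 1 => inferInstanceAs (AddCommGroup
      (((Fin (n + 1) → S) → V) × ((Fin (n + 1) → T) → W) × ((Fin n → S) → W)))

instance instModuleMorphismCochain : ∀ n, Module ℝ (MorphismCochain S T V W n)
  | 0 => inferInstanceAs (Module ℝ V)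
  | n + 1 => inferInstanceAs (Module ℝ
      (((Fin (n + 1) → S) → V) × ((Fin (n + 1) → T) → W) × ((Fin n → S) → W)))

/-- The subspaces `V` in degree `0`, and `Aⁿ ⊕ Bⁿ ⊕ Cⁿ⁻¹` in degree `n ≥ 1`. -/
def morphismCochains (A : ∀ n, Submodule ℝ ((Fin n → S) → V))
    (B : ∀ n, Submodule ℝ ((Fin n → T) → W)) (C : ∀ n, Submodule ℝ ((Fin n → S) → W)) :
    ∀ n, Submodule ℝ (MorphismCochain S T V W n)
  | 0 => (⊤ : Submodule ℝ V)
  | n + 1 => (A (n + 1)).prod ((B (n + 1)).prod (C n))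

/-- The differential `v ↦ (d₁ v, d₂ (ψ v), 0)` in degree `0`, and
`(θ, γ, η) ↦ (d₁ θ, d₂ γ, ψ ∘ θ - γ ∘ φⁿ - d₃ η)` in degree `n ≥ 1`. -/
def morphismDifferential
    (d₁ : ∀ n, ((Fin n → S) → V) →ₗ[ℝ] ((Fin (n + 1) → S) → V))
    (d₂ : ∀ n, ((Fin n → T) → W) →ₗ[ℝ] ((Fin (n + 1) → T) → W))
    (d₃ : ∀ n, ((Fin n → S) → W) →ₗ[ℝ] ((Fin (n + 1) → S) → W))
    (φ : S → T) (ψ : V →ₗ[ℝ] W) :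
    ∀ n, MorphismCochain S T V W n →ₗ[ℝ] MorphismCochain S T V W (n + 1)
  | 0 =>
    { toFun := fun v : V ↦ (d₁ 0 (fun _ ↦ v), d₂ 0 (fun _ ↦ ψ v), 0)
      map_add' := fun v v' : V ↦ by
        refine Prod.ext ((d₁ 0).map_add (fun _ ↦ v) (fun _ ↦ v')) (Prod.ext ?_ (add_zero _).symm)
        refine Eq.trans ?_ ((d₂ 0).map_add (fun _ ↦ ψ v) (fun _ ↦ ψ v'))
        exact congrArg (d₂ 0) (funext fun _ ↦ ψ.map_add v v')
      map_smul' := fun r (v : V) ↦ by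
        refine Prod.ext ((d₁ 0).map_smul r (fun _ ↦ v)) (Prod.ext ?_ (smul_zero _).symm)
        refine Eq.trans ?_ ((d₂ 0).map_smul r (fun _ ↦ ψ v))
        exact congrArg (d₂ 0) (funext fun _ ↦ ψ.map_smul r v) }
  | n + 1 =>
    { toFun := fun c : ((Fin (n + 1) → S) → V) × ((Fin (n + 1) → T) → W) × ((Fin n → S) → W) ↦
        (d₁ (n + 1) c.1, d₂ (n + 1) c.2.1, fun x ↦ ψ (c.1 x) - c.2.1 (φ ∘ x) - d₃ n c.2.2 x)
      map_add' := fun (c e : ((Fin (n + 1) → S) → V) × ((Fin (n + 1) → T) → W) × ((Fin n → S) → W)) ↦ by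
        refine Prod.ext ((d₁ _).map_add c.1 e.1) (Prod.ext ((d₂ _).map_add c.2.1 e.2.1) ?_)
        funext x
        change ψ (c.1 x + e.1 x) - (c.2.1 (φ ∘ x) + e.2.1 (φ ∘ x)) - d₃ n (c.2.2 + e.2.2) x =
          (ψ (c.1 x) - c.2.1 (φ ∘ x) - d₃ n c.2.2 x) + (ψ (e.1 x) - e.2.1 (φ ∘ x) - d₃ n e.2.2 x)
        rw [map_add, map_add, Pi.add_apply]
        abel
      map_smul' := fun r (c : ((Fin (n + 1) → S) → V) × ((Fin (n + 1) → T) → W) × ((Fin n → S) → W)) ↦ by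
        refine Prod.ext ((d₁ _).map_smul r c.1) (Prod.ext ((d₂ _).map_smul r c.2.1) ?_)
        funext x
        change ψ (r • c.1 x) - r • c.2.1 (φ ∘ x) - d₃ n (r • c.2.2) x =
          r • (ψ (c.1 x) - c.2.1 (φ ∘ x) - d₃ n c.2.2 x)
        rw [map_smul, map_smul, Pi.smul_apply, smul_sub, smul_sub] }

end MorphismCochains

/-! ### Morphism Lie algebras -/

section MorphismLieAlgebra

variable {L M V W : Type u} [LieRing L] [LieAlgebra ℝ L] [LieRing M] [LieAlgebra ℝ M]
  [AddCommGroup V] [Module ℝ V] [AddCommGroup W] [Module ℝ W]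

/-- The cochains of a morphism Lie algebra `L → M` with coefficients in `V → W`: `V` in degree `0`,
and `Hom(⋀ⁿ L, V) ⊕ Hom(⋀ⁿ M, W) ⊕ Hom(⋀ⁿ⁻¹ L, W)` in degree `n ≥ 1`. -/
def mlaCochains (L M V W : Type u) [LieRing L] [LieAlgebra ℝ L] [LieRing M] [LieAlgebra ℝ M]
    [AddCommGroup V] [Module ℝ V] [AddCommGroup W] [Module ℝ W] :
    ∀ n, Submodule ℝ (MorphismCochain L M V W n) :=
  morphismCochains (ceCochains L V) (ceCochains M W) (ceCochains L W)

/-- The differential of the morphism Lie algebra `φ : L → M` with coefficients in the representation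
`(ρV, ρW, ψ)`. The third summand uses the representation `ρW ∘ φ` of `L` on `W`. -/
def mlaDifferential (φ : L →ₗ⁅ℝ⁆ M) (ρV : L →ₗ⁅ℝ⁆ Module.End ℝ V) (ρW : M →ₗ⁅ℝ⁆ Module.End ℝ W)
    (ψ : V →ₗ[ℝ] W) :
    ∀ n, MorphismCochain L M V W n →ₗ[ℝ] MorphismCochain L M V W (n + 1) :=
  morphismDifferential (ceDifferential ρV) (ceDifferential ρW) (ceDifferential (ρW.comp φ)) φ ψ

end MorphismLieAlgebra

/-! ### Derivatives along vector fields and Lie brackets -/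

section

open VectorField

variable {E F M : Type*} [NormedAddCommGroup E] [NormedSpace ℝ E]
    [NormedAddCommGroup F] [NormedSpace ℝ F]
    [TopologicalSpace M] [ChartedSpace E M]

/-- The derivative at `x` of the vector-valued function `f` in the direction of the tangent
vector `v`. -/
def dirDeriv (f : M → F) (x : M) (v : TangentSpace 𝓘(ℝ, E) x) : F :=
  mfderiv 𝓘(ℝ, E) 𝓘(ℝ, F) f x v

theorem mfderiv_eq_fderiv_chart {h : M → F} {x : M}
    (hh : MDifferentiableAt 𝓘(ℝ, E) 𝓘(ℝ, F) h x) (v : TangentSpace 𝓘(ℝ, E) x) :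
    dirDeriv h x v =
      fderiv ℝ (h ∘ (extChartAt 𝓘(ℝ, E) x).symm) (extChartAt 𝓘(ℝ, E) x x) v := by
  simp only [dirDeriv, mfderiv, hh, writtenInExtChartAt]
  simp only [modelWithCornersSelf_coe, Set.range_id, fderivWithin_univ]
  rfl

theorem mfderiv_mlieBracket_eq [CompleteSpace E] [IsManifold 𝓘(ℝ, E) ∞ M]
    {f : M → F} {x : M} (hf : ContMDiffAt 𝓘(ℝ, E) 𝓘(ℝ, F) ∞ f x)
    {V W : Π y : M, TangentSpace 𝓘(ℝ, E) y}
    (hV : MDifferentiableAt 𝓘(ℝ, E) 𝓘(ℝ, E).tangent (fun y ↦ (V y : TangentBundle 𝓘(ℝ, E) M)) x)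
    (hW : MDifferentiableAt 𝓘(ℝ, E) 𝓘(ℝ, E).tangent (fun y ↦ (W y : TangentBundle 𝓘(ℝ, E) M)) x)
    {v w : M → F} (hv : ∀ᶠ y in nhds x, dirDeriv f y (V y) = v y)
    (hw : ∀ᶠ y in nhds x, dirDeriv f y (W y) = w y)
    (hvd : MDifferentiableAt 𝓘(ℝ, E) 𝓘(ℝ, F) v x)
    (hwd : MDifferentiableAt 𝓘(ℝ, E) 𝓘(ℝ, F) w x) :
    dirDeriv f x (mlieBracket 𝓘(ℝ, E) V W x) =
      dirDeriv w x (V x) -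
      dirDeriv v x (W x) := by
  have : IsManifold 𝓘(ℝ, E) 2 M := IsManifold.of_le (n := ∞) (by norm_cast)
  have : IsManifold 𝓘(ℝ, E) 1 M := IsManifold.of_le (n := ∞) (by norm_cast)
  set φ := extChartAt 𝓘(ℝ, E) x with hφ
  set V' : E → E := mpullbackWithin 𝓘(ℝ, E) 𝓘(ℝ, E) φ.symm V Set.univ with hV'
  set W' : E → E := mpullbackWithin 𝓘(ℝ, E) 𝓘(ℝ, E) φ.symm W Set.univ with hW'
  have hrange : Set.range 𝓘(ℝ, E) = Set.univ := by simp
  have hB : (mlieBracket 𝓘(ℝ, E) V W x : E) = lieBracket ℝ V' W' (φ x) := by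
    have h1 := mlieBracketWithin_apply (I := 𝓘(ℝ, E)) (V := V) (W := W) (s := Set.univ) (x₀ := x)
    have h2 : ∀ T : E →L[ℝ] E, T = ContinuousLinearMap.id ℝ E → ∀ Z, T.inverse Z = Z := by
      rintro _ rfl Z
      rw [ContinuousLinearMap.inverse_id]
      rfl
    refine h1.trans ((h2 _ mfderiv_extChartAt_self _).trans ?_)
    simp only [hrange, Set.preimage_univ, Set.univ_inter]
    exact congrFun lieBracketWithin_univ _
  have hfd : MDifferentiableAt 𝓘(ℝ, E) 𝓘(ℝ, F) f x := hf.mdifferentiableAt (by simp)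
  have hf' : ContDiffAt ℝ 2 (f ∘ φ.symm) (φ x) := by
    have h2 := (contMDiffAt_iff (f := f) (x := x) (n := ∞)
      (I := 𝓘(ℝ, E)) (I' := 𝓘(ℝ, F))).1 hf
    have h3 := h2.2
    simp only [hrange, contDiffWithinAt_univ] at h3
    exact ContDiffAt.of_le h3 (by norm_cast)
  have hdV : DifferentiableAt ℝ V' (φ x) := by
    have := MDifferentiableWithinAt.differentiableWithinAt_mpullbackWithin_vectorField
      (I := 𝓘(ℝ, E)) (V := V) (x := x) (s := Set.univ) hV.mdifferentiableWithinAt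
    simp only [hrange, Set.preimage_univ, Set.univ_inter] at this
    exact differentiableWithinAt_univ.1 this
  have hdW : DifferentiableAt ℝ W' (φ x) := by
    have := MDifferentiableWithinAt.differentiableWithinAt_mpullbackWithin_vectorField
      (I := 𝓘(ℝ, E)) (V := W) (x := x) (s := Set.univ) hW.mdifferentiableWithinAt
    simp only [hrange, Set.preimage_univ, Set.univ_inter] at this
    exact differentiableWithinAt_univ.1 this
  have key : ∀ (U : Π y : M, TangentSpace 𝓘(ℝ, E) y) (u : M → F),
      (∀ᶠ y in nhds x, dirDeriv f y (U y) = u y) →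
      (fun z : E ↦ fderiv ℝ (f ∘ φ.symm) z
        (mpullbackWithin 𝓘(ℝ, E) 𝓘(ℝ, E) φ.symm U Set.univ z)) =ᶠ[nhds (φ x)] u ∘ φ.symm := by
    intro U u hu
    have h1 : ∀ᶠ z in nhds (φ x), z ∈ φ.target := extChartAt_target_mem_nhds x
    have hc : Filter.Tendsto φ.symm (nhds (φ x)) (nhds x) := by
      have := continuousAt_extChartAt_symm (I := 𝓘(ℝ, E)) x
      rw [ContinuousAt, extChartAt_to_inv] at this
      exact this
    have h2 := hc.eventually hu
    have h3 := hc.eventually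
      ((contMDiffAt_iff_contMDiffAt_nhds (n := 1) (by simp)).1 (hf.of_le (by norm_cast)))
    filter_upwards [h1, h2, h3] with z hz hz2 hz3
    have hinv := isInvertible_mfderivWithin_extChartAt_symm (I := 𝓘(ℝ, E)) hz
    have hd := mdifferentiableWithinAt_extChartAt_symm (I := 𝓘(ℝ, E)) hz
    rw [hrange] at hinv hd
    have hcomp := mfderiv_comp z (hz3.mdifferentiableAt (by simp)) (mdifferentiableWithinAt_univ.1 hd)
    rw [mfderiv_eq_fderiv] at hcomp
    rw [hcomp]
    simp only [mpullbackWithin_apply, Function.comp]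
    rw [mfderivWithin_univ] at hinv ⊢
    rw [← hz2]
    change mfderiv _ _ f _ ((mfderiv 𝓘(ℝ, E) 𝓘(ℝ, E) φ.symm z) _) = _
    rw [hinv.self_apply_inverse]
    rfl
  have e0 : ∀ U : Π y : M, TangentSpace 𝓘(ℝ, E) y,
      mpullbackWithin 𝓘(ℝ, E) 𝓘(ℝ, E) φ.symm U Set.univ (φ x) = U x := by
    intro U
    have := mfderivWithin_extChartAt_symm_inverse_apply (I := 𝓘(ℝ, E)) (x := x)
      (U (φ.symm (φ x)))
    rw [hrange] at this
    rw [mpullbackWithin_apply, this, extChartAt_to_inv]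
  rw [mfderiv_eq_fderiv_chart hfd, hB, mfderiv_eq_fderiv_chart hwd, mfderiv_eq_fderiv_chart hvd,
    fderiv_apply_lieBracket hf' (by simp) hdW hdV]
  congr 1
  · rw [(key W w hw).fderiv_eq, hV', e0]
  · rw [(key V v hv).fderiv_eq, hW', e0]

theorem mdifferentiableAt_dirDeriv_extChartAt [IsManifold 𝓘(ℝ, E) ∞ M] {x : M}
    {U : Π y : M, TangentSpace 𝓘(ℝ, E) y}
    (hU : MDifferentiableAt 𝓘(ℝ, E) 𝓘(ℝ, E).tangent (fun y ↦ (U y : TangentBundle 𝓘(ℝ, E) M)) x) :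
    MDifferentiableAt 𝓘(ℝ, E) 𝓘(ℝ, E)
      (fun y ↦ dirDeriv (extChartAt 𝓘(ℝ, E) x) y (U y)) x := by
  have : IsManifold 𝓘(ℝ, E) 1 M := IsManifold.of_le (n := ∞) (by norm_cast)
  rw [mdifferentiableAt_section] at hU
  refine hU.congr_of_eventuallyEq ?_
  filter_upwards [(chartAt E x).open_source.mem_nhds (mem_chart_source E x)] with y hy
  rw [dirDeriv, ← TangentBundle.continuousLinearMapAt_trivializationAt hy]
  have h2 := Bundle.Trivialization.linearMapAt_apply (R := ℝ)
    (trivializationAt E (TangentSpace 𝓘(ℝ, E)) x) (b := y) (U y)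
  rw [if_pos (by simpa using hy)] at h2
  exact h2
end

section
variable {E : Type*} [NormedAddCommGroup E] [NormedSpace ℝ E]
  {F : Type*} [NormedAddCommGroup F] [NormedSpace ℝ F]
  {G : Type*} [TopologicalSpace G] [ChartedSpace E G] [Group G] [LieGroup 𝓘(ℝ, E) ∞ G]
  {H : Type*} [TopologicalSpace H] [ChartedSpace F H] [Group H] [LieGroup 𝓘(ℝ, F) ∞ H]

/-- A smooth Lie group has the regularity that Mathlib asks for to define its Lie algebra. -/
instance lieGroup_minSmoothness : LieGroup 𝓘(ℝ, E) (minSmoothness ℝ 3) G :=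
  LieGroup.of_le (n := ∞) (by rw [minSmoothness_of_isRCLikeNormedField]; norm_cast)

theorem mfderiv_mulInvariantVectorField (Φ : ContMDiffMonoidMorphism 𝓘(ℝ, E) 𝓘(ℝ, F) ∞ G H)
    (X : GroupLieAlgebra 𝓘(ℝ, E) G) (g : G) :
    (mfderiv 𝓘(ℝ, E) 𝓘(ℝ, F) Φ g (mulInvariantVectorField X g) : F) =
      mulInvariantVectorField (I := 𝓘(ℝ, F)) (G := H) (mfderiv 𝓘(ℝ, E) 𝓘(ℝ, F) Φ 1 X : F) (Φ g) := by
  have hΦ : ∀ g, MDifferentiableAt 𝓘(ℝ, E) 𝓘(ℝ, F) Φ g :=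
    fun g ↦ Φ.contMDiff_toFun.mdifferentiableAt (by simp)
  have hL : MDifferentiableAt 𝓘(ℝ, E) 𝓘(ℝ, E) (fun h : G ↦ g * h) 1 :=
    (contMDiff_mul_left (I := 𝓘(ℝ, E)) (n := ∞) (a := g)).mdifferentiableAt (by simp)
  have hL' : ∀ k, MDifferentiableAt 𝓘(ℝ, F) 𝓘(ℝ, F) (fun h : H ↦ Φ g * h) k := fun k ↦
    (contMDiff_mul_left (I := 𝓘(ℝ, F)) (n := ∞) (a := Φ g)).mdifferentiableAt (by simp)
  have h1 := mfderiv_comp_apply (I' := 𝓘(ℝ, E)) (I'' := 𝓘(ℝ, F)) (1 : G)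
    (by simpa using hΦ (g * 1)) hL X
  have h2 := mfderiv_comp_apply (I' := 𝓘(ℝ, F)) (I'' := 𝓘(ℝ, F)) (1 : G) (hL' (Φ 1)) (hΦ 1) X
  have h3 : (Φ ∘ fun h ↦ g * h) = (fun h ↦ Φ g * h) ∘ Φ := by ext; simp
  rw [h3, h2] at h1
  have e1 : ∀ (k : H) (Y : F), k = 1 → (mfderiv 𝓘(ℝ, F) 𝓘(ℝ, F) (fun h : H ↦ Φ g * h) k Y : F) =
      (mfderiv 𝓘(ℝ, F) 𝓘(ℝ, F) (fun h : H ↦ Φ g * h) 1 Y : F) := by rintro k Y rfl; rfl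
  have e2 : ∀ (k : G) (Y : E), k = g → (mfderiv 𝓘(ℝ, E) 𝓘(ℝ, F) Φ k Y : F) =
      (mfderiv 𝓘(ℝ, E) 𝓘(ℝ, F) Φ g Y : F) := by rintro k Y rfl; rfl
  exact ((e2 _ _ (mul_one g)).symm.trans h1.symm).trans (e1 _ _ (map_one Φ))

theorem mulInvariantVectorField_at_one (Z : E) :
    mulInvariantVectorField (I := 𝓘(ℝ, E)) (G := G) Z 1 = Z := by
  have h : ∀ f : G → G, f = id → ∀ Z : E, (mfderiv 𝓘(ℝ, E) 𝓘(ℝ, E) f 1 Z : E) = Z := by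
    rintro _ rfl Z
    rw [mfderiv_id]
    rfl
  exact h _ (by ext; simp) Z

/-- The tangent map at the identity of a morphism of Lie groups. -/
def tangentAtOne (Φ : ContMDiffMonoidMorphism 𝓘(ℝ, E) 𝓘(ℝ, F) ∞ G H) :
    GroupLieAlgebra 𝓘(ℝ, E) G →ₗ[ℝ] GroupLieAlgebra 𝓘(ℝ, F) H :=
  ContinuousLinearMap.toLinearMap (M := E) (M₂ := F) (mfderiv 𝓘(ℝ, E) 𝓘(ℝ, F) Φ 1)

theorem tangentAtOne_lie [CompleteSpace E] [CompleteSpace F]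
    (Φ : ContMDiffMonoidMorphism 𝓘(ℝ, E) 𝓘(ℝ, F) ∞ G H)
    (X Y : GroupLieAlgebra 𝓘(ℝ, E) G) :
    tangentAtOne Φ ⁅X, Y⁆ = ⁅tangentAtOne Φ X, tangentAtOne Φ Y⁆ := by
  have hΦ : ∀ g, MDifferentiableAt 𝓘(ℝ, E) 𝓘(ℝ, F) Φ g :=
    fun g ↦ Φ.contMDiff_toFun.mdifferentiableAt (by simp)
  have hΦ1 : Φ 1 = 1 := map_one Φ
  set χ : H → F := (extChartAt 𝓘(ℝ, F) (1 : H) : H → F) with hχ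
  have hχs : ∀ᶠ h in nhds (1 : H), MDifferentiableAt 𝓘(ℝ, F) 𝓘(ℝ, F) χ h := by
    filter_upwards [(chartAt F (1 : H)).open_source.mem_nhds (mem_chart_source F 1)] with h hh
    exact mdifferentiableAt_extChartAt hh
  have htend : Filter.Tendsto Φ (nhds (1 : G)) (nhds (1 : H)) := by
    simpa [ContinuousAt, hΦ1] using (hΦ 1).continuousAt
  have hχc : ContMDiffAt 𝓘(ℝ, F) 𝓘(ℝ, F) ∞ χ 1 := contMDiffAt_extChartAt
  have hχc' : ContMDiffAt 𝓘(ℝ, F) 𝓘(ℝ, F) ∞ χ (Φ 1) := by rw [hΦ1]; exact hχc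
  have hf : ContMDiffAt 𝓘(ℝ, E) 𝓘(ℝ, F) ∞ (χ ∘ Φ) 1 :=
    hχc'.comp 1 Φ.contMDiff_toFun.contMDiffAt
  let L : E → F := fun X ↦ mfderiv 𝓘(ℝ, E) 𝓘(ℝ, F) Φ 1 X
  let u : GroupLieAlgebra 𝓘(ℝ, F) H → H → F :=
    fun Z h ↦ dirDeriv χ h (mulInvariantVectorField Z h)
  have hu : ∀ Z, MDifferentiableAt 𝓘(ℝ, F) 𝓘(ℝ, F) (u Z) 1 := fun Z ↦
    mdifferentiableAt_dirDeriv_extChartAt (mdifferentiableAt_mulInvariantVectorField Z)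
  have hu' : ∀ Z, MDifferentiableAt 𝓘(ℝ, F) 𝓘(ℝ, F) (u Z) (Φ 1) := fun Z ↦ by
    rw [hΦ1]; exact hu Z
  have hcomp : ∀ Z : E, ∀ᶠ g in nhds (1 : G),
      dirDeriv (χ ∘ Φ) g (mulInvariantVectorField (I := 𝓘(ℝ, E)) (G := G) Z g) = (u (L Z) ∘ Φ) g := by
    intro Z
    filter_upwards [htend.eventually hχs] with g hg
    refine (mfderiv_comp_apply g hg (hΦ g) _).trans ?_
    exact congrArg (mfderiv 𝓘(ℝ, F) 𝓘(ℝ, F) χ (Φ g)) (mfderiv_mulInvariantVectorField Φ Z g)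
  have hd : ∀ Z : F, ∀ Z' : E, dirDeriv (u Z ∘ Φ) (1 : G) Z' = dirDeriv (u Z) (1 : H) (L Z') := by
    intro Z Z'
    refine (mfderiv_comp_apply (1 : G) (hu' Z) (hΦ 1) Z').trans ?_
    have e1 : ∀ (k : H) (Y : F), k = 1 → (mfderiv 𝓘(ℝ, F) 𝓘(ℝ, F) (u Z) k Y : F) =
      (mfderiv 𝓘(ℝ, F) 𝓘(ℝ, F) (u Z) 1 Y : F) := by rintro k Y rfl; rfl
    exact e1 _ _ hΦ1
  have hone : ∀ Z : E, mulInvariantVectorField (I := 𝓘(ℝ, E)) (G := G) Z 1 = Z := 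
    mulInvariantVectorField_at_one
  have hone' : ∀ Z : F, mulInvariantVectorField (I := 𝓘(ℝ, F)) (G := H) Z 1 = Z := 
    mulInvariantVectorField_at_one
  have main := mfderiv_mlieBracket_eq hf
    (mdifferentiableAt_mulInvariantVectorField X) (mdifferentiableAt_mulInvariantVectorField Y)
    (hcomp X) (hcomp Y) ((hu' (L X)).comp 1 (hΦ 1)) ((hu' (L Y)).comp 1 (hΦ 1))
  have main' := mfderiv_mlieBracket_eq hχc
    (mdifferentiableAt_mulInvariantVectorField (L X)) (mdifferentiableAt_mulInvariantVectorField (L Y))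
    (v := u (L X)) (w := u (L Y))
    (Filter.Eventually.of_forall fun _ ↦ rfl) (Filter.Eventually.of_forall fun _ ↦ rfl)
    (hu _) (hu _)
  have main2 : dirDeriv (χ ∘ Φ) (1 : G) (⁅X, Y⁆ : GroupLieAlgebra 𝓘(ℝ, E) G) =
      dirDeriv (u (L Y) ∘ Φ) (1 : G) X - dirDeriv (u (L X) ∘ Φ) (1 : G) Y :=
    main.trans (congrArg₂ (· - ·) (congrArg (dirDeriv (u (L Y) ∘ Φ) (1 : G)) (hone X))
      (congrArg (dirDeriv (u (L X) ∘ Φ) (1 : G)) (hone Y)))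
  have main2' : dirDeriv χ (1 : H) (⁅tangentAtOne Φ X, tangentAtOne Φ Y⁆ : GroupLieAlgebra 𝓘(ℝ, F) H) =
      dirDeriv (u (L Y)) (1 : H) (L X) - dirDeriv (u (L X)) (1 : H) (L Y) :=
    main'.trans (congrArg₂ (· - ·) (congrArg (dirDeriv (u (L Y)) (1 : H)) (hone' (L X)))
      (congrArg (dirDeriv (u (L X)) (1 : H)) (hone' (L Y))))
  have hid : ∀ Z : F, dirDeriv χ (1 : H) Z = Z := by
    intro Z
    exact congrArg (fun T : F →L[ℝ] F ↦ T Z) (mfderiv_extChartAt_self (I := 𝓘(ℝ, F)) (x := (1 : H)))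
  have h3 : dirDeriv (χ ∘ Φ) (1 : G) (⁅X, Y⁆ : GroupLieAlgebra 𝓘(ℝ, E) G) =
      L (⁅X, Y⁆ : GroupLieAlgebra 𝓘(ℝ, E) G) := by
    refine (mfderiv_comp_apply (1 : G) (hχc'.mdifferentiableAt (by simp)) (hΦ 1) _).trans ?_
    have e1 : ∀ (k : H) (Y : F), k = 1 → (mfderiv 𝓘(ℝ, F) 𝓘(ℝ, F) χ k Y : F) = Y := by
      rintro k Y rfl; exact hid Y
    exact e1 _ _ hΦ1
  exact h3.symm.trans (main2.trans ((congrArg₂ (· - ·) (hd (L Y) X) (hd (L X) Y)).trans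
    (main2'.symm.trans (hid _))))

theorem dirDeriv_lie [CompleteSpace E] {A : Type*} [NormedRing A] [NormedAlgebra ℝ A]
    {f : G → A} (hf : ContMDiff 𝓘(ℝ, E) 𝓘(ℝ, A) ∞ f) (hmul : ∀ g h, f (g * h) = f g * f h) (X Y : GroupLieAlgebra 𝓘(ℝ, E) G) :
    dirDeriv f 1 ⁅X, Y⁆ = ⁅dirDeriv f 1 X, dirDeriv f 1 Y⁆ := by
  have hfd : ∀ g, MDifferentiableAt 𝓘(ℝ, E) 𝓘(ℝ, A) f g := fun g ↦ hf.mdifferentiableAt (by simp)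
  have hone : ∀ Z : E, mulInvariantVectorField (I := 𝓘(ℝ, E)) (G := G) Z 1 = Z := 
    mulInvariantVectorField_at_one
  have hR : ∀ (a : A) (g : G), HasMFDerivAt 𝓘(ℝ, E) 𝓘(ℝ, A) (fun g ↦ f g * a) g
      (((ContinuousLinearMap.mul ℝ A).flip a).comp
        (mfderiv 𝓘(ℝ, E) 𝓘(ℝ, A) f g : E →L[ℝ] A)) := fun a g ↦
    ((ContinuousLinearMap.mul ℝ A).flip a).hasMFDerivAt.comp g (hfd g).hasMFDerivAt
  have hLm : ∀ (a : A) (g : G), HasMFDerivAt 𝓘(ℝ, E) 𝓘(ℝ, A) (fun g ↦ a * f g) g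
      ((ContinuousLinearMap.mul ℝ A a).comp
        (mfderiv 𝓘(ℝ, E) 𝓘(ℝ, A) f g : E →L[ℝ] A)) := fun a g ↦
    (ContinuousLinearMap.mul ℝ A a).hasMFDerivAt.comp g (hfd g).hasMFDerivAt
  have hv : ∀ Z : E, ∀ g, dirDeriv f g (mulInvariantVectorField (I := 𝓘(ℝ, E)) (G := G) Z g) =
      f g * dirDeriv f (1 : G) Z := by
    intro Z g
    have hL : MDifferentiableAt 𝓘(ℝ, E) 𝓘(ℝ, E) (fun h : G ↦ g * h) 1 :=
      (contMDiff_mul_left (I := 𝓘(ℝ, E)) (n := ∞) (a := g)).mdifferentiableAt (by simp)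
    have h1 := mfderiv_comp_apply (I' := 𝓘(ℝ, E)) (I'' := 𝓘(ℝ, A)) (1 : G)
      (hfd (g * 1)) hL Z
    have h3 : (f ∘ fun h ↦ g * h) = fun h ↦ f g * f h := by ext; simp [hmul]
    rw [h3, (hLm (f g) 1).mfderiv] at h1
    have e2 : ∀ (k : G) (Y : E), k = g → (mfderiv 𝓘(ℝ, E) 𝓘(ℝ, A) f k Y : A) =
      (mfderiv 𝓘(ℝ, E) 𝓘(ℝ, A) f g Y : A) := by rintro k Y rfl; rfl
    exact ((e2 _ _ (mul_one g)).symm.trans h1.symm)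
  have main := mfderiv_mlieBracket_eq (hf 1)
    (mdifferentiableAt_mulInvariantVectorField X) (mdifferentiableAt_mulInvariantVectorField Y)
    (Filter.Eventually.of_forall (hv X)) (Filter.Eventually.of_forall (hv Y))
    (hR _ 1).mdifferentiableAt (hR _ 1).mdifferentiableAt
  have main2 : dirDeriv f (1 : G) (⁅X, Y⁆ : GroupLieAlgebra 𝓘(ℝ, E) G) =
      dirDeriv (fun g ↦ f g * dirDeriv f (1 : G) Y) (1 : G) X -
        dirDeriv (fun g ↦ f g * dirDeriv f (1 : G) X) (1 : G) Y :=
    main.trans (congrArg₂ (· - ·) (congrArg (dirDeriv _ (1 : G)) (hone X))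
      (congrArg (dirDeriv _ (1 : G)) (hone Y)))
  have hRd : ∀ (a : A) (Z : E), dirDeriv (fun g ↦ f g * a) (1 : G) Z = dirDeriv f (1 : G) Z * a := by
    intro a Z
    exact congrArg (fun T : E →L[ℝ] A ↦ T Z) (hR a 1).mfderiv
  exact main2.trans (congrArg₂ (· - ·) (hRd _ X) (hRd _ Y))
end

/-! ### Morphism Lie groups -/

section MorphismLieGroup

variable {E F G H V W : Type u}
  [NormedAddCommGroup E] [NormedSpace ℝ E] [FiniteDimensional ℝ E]
  [NormedAddCommGroup F] [NormedSpace ℝ F] [FiniteDimensional ℝ F]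
  [TopologicalSpace G] [ChartedSpace E G] [Group G] [LieGroup 𝓘(ℝ, E) ∞ G]
  [TopologicalSpace H] [ChartedSpace F H] [Group H] [LieGroup 𝓘(ℝ, F) ∞ H]
  [NormedAddCommGroup V] [NormedSpace ℝ V] [FiniteDimensional ℝ V]
  [NormedAddCommGroup W] [NormedSpace ℝ W] [FiniteDimensional ℝ W]

/-- The Lie algebra homomorphism `Lie(Φ) : Lie(G) → Lie(H)`, the tangent map of `Φ` at `1`. -/
def lieHom (Φ : ContMDiffMonoidMorphism 𝓘(ℝ, E) 𝓘(ℝ, F) ∞ G H) :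
    GroupLieAlgebra 𝓘(ℝ, E) G →ₗ⁅ℝ⁆ GroupLieAlgebra 𝓘(ℝ, F) H :=
  { tangentAtOne Φ with map_lie' := fun {X Y} ↦ tangentAtOne_lie Φ X Y }

/-- A Lie group homomorphism `ϱ : G → Aut(V)`, as a representation of the abstract group `G`. -/
def groupRep (ϱ : ContMDiffMonoidMorphism 𝓘(ℝ, E) 𝓘(ℝ, V →L[ℝ] V) ∞ G (V →L[ℝ] V)ˣ) :
    Representation ℝ G V where
  toFun g := ((ϱ g : V →L[ℝ] V) : V →ₗ[ℝ] V)
  map_one' := by rw [map_one]; rfl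
  map_mul' g h := by rw [map_mul]; rfl

/-- A Lie group homomorphism into `Aut(V)` is smooth as a map into `End(V)`. -/
theorem contMDiff_val_rep (ϱ : ContMDiffMonoidMorphism 𝓘(ℝ, E) 𝓘(ℝ, V →L[ℝ] V) ∞ G (V →L[ℝ] V)ˣ) :
    ContMDiff 𝓘(ℝ, E) 𝓘(ℝ, V →L[ℝ] V) ∞ (fun g ↦ (ϱ g : V →L[ℝ] V)) :=
  Units.contMDiff_val.comp ϱ.contMDiff_toFun

/-- The representation of `Lie(G)` on `V` induced by a Lie group homomorphism `ϱ : G → Aut(V)`: the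
derivative of `ϱ` at `1`. -/
def lieRep (ϱ : ContMDiffMonoidMorphism 𝓘(ℝ, E) 𝓘(ℝ, V →L[ℝ] V) ∞ G (V →L[ℝ] V)ˣ) :
    GroupLieAlgebra 𝓘(ℝ, E) G →ₗ⁅ℝ⁆ Module.End ℝ V where
  toFun X := ((dirDeriv (fun g ↦ (ϱ g : V →L[ℝ] V)) 1 X : V →L[ℝ] V) : V →ₗ[ℝ] V)
  map_add' X Y := by
    simp only [dirDeriv, map_add]; rfl
  map_smul' r X := by
    simp only [dirDeriv, map_smul]; rfl
  map_lie' := fun {X Y} ↦ by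
    rw [dirDeriv_lie (contMDiff_val_rep ϱ) (fun g h ↦ by rw [map_mul]; rfl)]
    rfl

/-- `lieRep ϱ X v` is the derivative at `0` of `ϱ (γ t) v`, for every curve `γ` through `1` with
velocity `X` at `0`; in particular for `γ t = exp (t X)`. -/
theorem hasDerivAt_lieRep
    (ϱ : ContMDiffMonoidMorphism 𝓘(ℝ, E) 𝓘(ℝ, V →L[ℝ] V) ∞ G (V →L[ℝ] V)ˣ)
    (γ : ℝ → G) (hγ : MDifferentiableAt 𝓘(ℝ, ℝ) 𝓘(ℝ, E) γ 0) (hγ0 : γ 0 = 1) (v : V) :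
    HasDerivAt (fun t ↦ (ϱ (γ t) : V →L[ℝ] V) v)
      (lieRep ϱ (mfderiv 𝓘(ℝ, ℝ) 𝓘(ℝ, E) γ 0 (1 : ℝ) : E) v) 0 := by
  have h1 : HasMFDerivAt 𝓘(ℝ, E) 𝓘(ℝ, V →L[ℝ] V) (fun g ↦ (ϱ g : V →L[ℝ] V)) (γ 0)
      (mfderiv 𝓘(ℝ, E) 𝓘(ℝ, V →L[ℝ] V) (fun g ↦ (ϱ g : V →L[ℝ] V)) (γ 0)) :=
    ((contMDiff_val_rep ϱ).mdifferentiableAt (by simp)).hasMFDerivAt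
  have h2 := h1.comp 0 hγ.hasMFDerivAt
  let D : ℝ →L[ℝ] V := (ContinuousLinearMap.apply ℝ V v).comp
    ((mfderiv 𝓘(ℝ, E) 𝓘(ℝ, V →L[ℝ] V) (fun g ↦ (ϱ g : V →L[ℝ] V)) (γ 0) : E →L[ℝ] (V →L[ℝ] V)).comp
      (mfderiv 𝓘(ℝ, ℝ) 𝓘(ℝ, E) γ 0 : ℝ →L[ℝ] E))
  have h3' : HasFDerivAt (fun t ↦ (ϱ (γ t) : V →L[ℝ] V) v) D 0 :=
    hasMFDerivAt_iff_hasFDerivAt.1 ((ContinuousLinearMap.apply ℝ V v).hasMFDerivAt.comp 0 h2)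
  have h3 := h3'.hasDerivAt
  have e : ∀ (k : G) (Z : E), k = 1 →
      (mfderiv 𝓘(ℝ, E) 𝓘(ℝ, V →L[ℝ] V) (fun g ↦ (ϱ g : V →L[ℝ] V)) k Z : V →L[ℝ] V) =
      dirDeriv (fun g ↦ (ϱ g : V →L[ℝ] V)) (1 : G) Z := by rintro k Z rfl; rfl
  have h4 := congrArg (fun T : V →L[ℝ] V ↦ T v)
    (e (γ 0) (mfderiv 𝓘(ℝ, ℝ) 𝓘(ℝ, E) γ 0 (1 : ℝ)) hγ0)
  exact HasDerivAt.congr_deriv h3 h4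

variable (E) in
/-- The differentiable group cochains: the smooth functions `f : Gⁿ → V` such that
`f (g₁, …, gₙ) = 0` as soon as some `gᵢ` is `1`. -/
def differentiableCochains (G V : Type u) [TopologicalSpace G] [ChartedSpace E G] [Group G]
    [NormedAddCommGroup V] [NormedSpace ℝ V] (n : ℕ) : Submodule ℝ ((Fin n → G) → V) where
  carrier := {f | ContMDiff (ModelWithCorners.pi fun _ : Fin n ↦ 𝓘(ℝ, E)) 𝓘(ℝ, V) ∞ f ∧
    ∀ g : Fin n → G, (∃ i, g i = 1) → f g = 0}
  add_mem' := fun {f f'} hf hf' ↦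
    ⟨hf.1.add hf'.1, fun g hg ↦ by rw [Pi.add_apply, hf.2 g hg, hf'.2 g hg, add_zero]⟩
  zero_mem' := ⟨contMDiff_const, fun _ _ ↦ rfl⟩
  smul_mem' := fun r f hf ↦
    ⟨(contDiff_const_smul r).contMDiff.comp hf.1, fun g hg ↦ by rw [Pi.smul_apply, hf.2 g hg, smul_zero]⟩

variable (E F) in
/-- The differentiable cochains of a morphism Lie group `G → H` with coefficients in `V → W`. -/
def mlgCochains (G H V W : Type u) [TopologicalSpace G] [ChartedSpace E G] [Group G]
    [TopologicalSpace H] [ChartedSpace F H] [Group H]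
    [NormedAddCommGroup V] [NormedSpace ℝ V] [NormedAddCommGroup W] [NormedSpace ℝ W] :
    ∀ n, Submodule ℝ (MorphismCochain G H V W n) :=
  morphismCochains (differentiableCochains E G V) (differentiableCochains F H W)
    (differentiableCochains E G W)

/-- The differential of the morphism Lie group `Φ : G → H` with coefficients in the module
`(V, W, ψ)`. The third summand uses the action `ϱW ∘ Φ` of `G` on `W`. -/
def mlgDifferential (Φ : ContMDiffMonoidMorphism 𝓘(ℝ, E) 𝓘(ℝ, F) ∞ G H)
    (ϱV : ContMDiffMonoidMorphism 𝓘(ℝ, E) 𝓘(ℝ, V →L[ℝ] V) ∞ G (V →L[ℝ] V)ˣ)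
    (ϱW : ContMDiffMonoidMorphism 𝓘(ℝ, F) 𝓘(ℝ, W →L[ℝ] W) ∞ H (W →L[ℝ] W)ˣ)
    (ψ : V →ₗ[ℝ] W) :
    ∀ n, MorphismCochain G H V W n →ₗ[ℝ] MorphismCochain G H V W (n + 1) :=
  morphismDifferential (groupDifferential (groupRep ϱV)) (groupDifferential (groupRep ϱW))
    (groupDifferential ((groupRep ϱW).comp Φ.toMonoidHom)) Φ ψ

/-- The operator `R_X` from functions of `n + 1` variables to functions of `n` variables:
differentiate in the first variable at `1`, in the direction `X`, which is the value at `1` of the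
right invariant vector field of `X`. -/
def diffFirst {n : ℕ} (X : GroupLieAlgebra 𝓘(ℝ, E) G) (f : (Fin (n + 1) → G) → V) :
    (Fin n → G) → V :=
  fun g ↦ dirDeriv (fun a : G ↦ f (Fin.cons a g)) 1 X

/-- The value obtained from `f` by applying `R_{X₁}` first, then `R_{X₂}`, …, and `R_{Xₙ}` last: `f`
is differentiated in its `i`-th variable in the direction `Xᵢ`. -/
def diffAll : ∀ n : ℕ, ((Fin n → G) → V) → (Fin n → GroupLieAlgebra 𝓘(ℝ, E) G) → V
  | 0, f, _ => f Fin.elim0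
  | n + 1, f, X => diffAll n (diffFirst (X 0) f) (Fin.tail X)

/-- The van Est map, the sum over all permutations `σ` of `sgn σ` times the iterated derivative of
`f` in the directions `X_{σ(1)}, …, X_{σ(n)}`. -/
def vanEst (n : ℕ) (f : (Fin n → G) → V) (X : Fin n → GroupLieAlgebra 𝓘(ℝ, E) G) : V :=
  ∑ σ : Equiv.Perm (Fin n), ((Equiv.Perm.sign σ : ℤ) : ℝ) • diffAll n f (X ∘ σ)

variable (E F G H V W) in
/-- The van Est map of morphism cochains: the identity of `V` in degree `0`, and the van Est map
in each component in degree `n ≥ 1`. -/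
def morphismVanEst : ∀ n, MorphismCochain G H V W n →
    MorphismCochain (GroupLieAlgebra 𝓘(ℝ, E) G) (GroupLieAlgebra 𝓘(ℝ, F) H) V W n
  | 0 => fun v : V ↦ v
  | n + 1 => fun c : ((Fin (n + 1) → G) → V) × ((Fin (n + 1) → H) → W) × ((Fin n → G) → W) ↦
      (vanEst (n + 1) c.1, vanEst (n + 1) c.2.1, vanEst n c.2.2)

end MorphismLieGroup

end

/-! Both differentials and the van Est map are governed by recursions that split off one variable,
and the chain map property follows by comparing them.

For a family `η` of `n`-cochains indexed by the Lie algebra, write U(η) for `uncurrySum η`, the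
alternating sum that feeds one argument to `η`, and B(ζ) for `bracketSum ζ`, the signed sum that
feeds it a bracket. The Chevalley-Eilenberg differential is U(z ↦ ρ(z) f) plus the bracket sum of
`f`. Splitting a permutation according to the image of 0 gives vE(f) = U(X ↦ vE(D_X f)), with D_X =
`diffFirst X` (`vanEst_succ`). On the group side, `groupDifferential_cons` expresses δf(a, g)
through δ(f(a, ·))(g). Its derivative at a = 1 is `diffFirst_groupDifferential`: D_X δf = ρ(X) f −
L_X f + g₀ D_X f(tail g) − δ(D_X f), with L_X = `diffLeft X`.

Apply vE and induct on `n`. The third term gives U(Y ↦ ρ(Y) vE(D_X f)), which cancels the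
representation part of δ vE(D_X f). What remains, summed over X, is the required formula once the
double sum over D_Y L_X is identified. By `uncurrySum_uncurrySum` a double sum depends only on the
commutator of its summand, and `diffFirst_diffLeft_sub` computes D_Y L_X − D_X L_Y = D_[X,Y]. This
is where the bracket of left invariant fields enters, through symmetry of mixed derivatives. The
identity is `vanEst_groupDifferential`.

The same calculus of U and B yields δ² = 0 for Chevalley-Eilenberg cochains, with the Jacobi
identity in `bracketSum_uncurrySum_lie`.

The morphism complexes are formal consequences: `isCochainComplex_morphism` needs only three
complexes and two cochain maps into the third. The action of G on W is treated as a Lie group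
representation of its own, `pullbackRep`, whose derivative is ρ_W ∘ φ. Naturality of vE under linear
maps and under Φ (`vanEst_clm`, `vanEst_comp`) then handles the third component. -/

set_option linter.unusedSectionVars false

/-! ### Alternating sums over one distinguished variable. -/

section Antisymmetrization

variable {L V W : Type u} [AddCommGroup V] [Module ℝ V] [AddCommGroup W] [Module ℝ W] {n : ℕ}

/-- The alternating sum `∑ i, (-1)^i η(xᵢ)(x₀, …, x̂ᵢ, …, xₙ)`. -/
noncomputable def uncurrySum (η : L → (Fin n → L) → V) (x : Fin (n + 1) → L) : V :=
  ∑ i : Fin (n + 1), (-1 : ℝ) ^ (i : ℕ) • η (x i) (i.removeNth x)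

theorem removeNth_succ_cons (i : Fin (n + 1)) (y : L) (x : Fin (n + 1) → L) :
    i.succ.removeNth (Fin.cons y x : Fin (n + 2) → L) =
      (Fin.cons y (i.removeNth x) : Fin (n + 1) → L) := by
  funext j
  refine Fin.cases ?_ (fun j ↦ ?_) j <;> simp [Fin.removeNth_apply]

theorem exists_eq_fin_cons (x : Fin (n + 1) → L) :
    ∃ (y : L) (w : Fin n → L), x = (Fin.cons y w : Fin (n + 1) → L) :=
  ⟨x 0, Fin.tail x, (Fin.cons_self_tail x).symm⟩

theorem uncurrySum_cons_zero (η : L → (Fin 0 → L) → V) (y : L) (x : Fin 0 → L) :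
    uncurrySum η (Fin.cons y x : Fin 1 → L) = η y x := by
  simp [uncurrySum]

/-- Either `y` is the extracted variable, or it stays in place and shifts the position of every
other one by one, hence the minus sign. With its analogue for `bracketSum`, this recursion replaces
index manipulations by inductions on the number of variables. -/
theorem uncurrySum_cons (η : L → (Fin (n + 1) → L) → V) (y : L) (x : Fin (n + 1) → L) :
    uncurrySum η (Fin.cons y x : Fin (n + 2) → L) =
      η y x - uncurrySum (fun z w ↦ η z (Fin.cons y w)) x := by
  simp [uncurrySum, Fin.sum_univ_succ (n := n + 1), removeNth_succ_cons,
    pow_succ, Finset.sum_neg_distrib, sub_eq_add_neg]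

theorem uncurrySum_add (η θ : L → (Fin n → L) → V) :
    uncurrySum (fun z w ↦ η z w + θ z w) = uncurrySum η + uncurrySum θ := by
  funext x; simp [uncurrySum, Finset.sum_add_distrib]

theorem uncurrySum_sub (η θ : L → (Fin n → L) → V) :
    uncurrySum (fun z w ↦ η z w - θ z w) = uncurrySum η - uncurrySum θ := by
  funext x; simp [uncurrySum, smul_sub]

theorem uncurrySum_neg (η : L → (Fin n → L) → V) :
    uncurrySum (fun z w ↦ - η z w) = - uncurrySum η := by
  funext x; simp [uncurrySum]

theorem uncurrySum_smul (r : ℝ) (η : L → (Fin n → L) → V) :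
    uncurrySum (fun z w ↦ r • η z w) = r • uncurrySum η := by
  funext x; simp [uncurrySum, Finset.smul_sum, smul_comm r]

theorem map_uncurrySum (A : V →ₗ[ℝ] W) (η : L → (Fin n → L) → V) (x : Fin (n + 1) → L) :
    A (uncurrySum η x) = uncurrySum (fun z w ↦ A (η z w)) x := by
  simp [uncurrySum, map_sum]

end Antisymmetrization

/-! ### Bracket sums, their commutation rules, and the Jacobi identity. -/

section BracketSum

variable {L V W : Type u} [LieRing L] [AddCommGroup V] [Module ℝ V]
  [AddCommGroup W] [Module ℝ W] {n : ℕ}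

/-- The sum `∑_{i<j} (-1)^(i+j) ζ([xᵢ, xⱼ])(x₀, …, x̂ᵢ, …, x̂ⱼ, …)`. -/
noncomputable def bracketSum (ζ : L → (Fin n → L) → V) (x : Fin (n + 2) → L) : V :=
  ∑ i : Fin (n + 2), ∑ j : Fin (n + 2),
    if h : i < j then
      (-1 : ℝ) ^ ((i : ℕ) + (j : ℕ)) •
        ζ ⁅x i, x j⁆ ((i.castPred (Fin.ne_last_of_lt h)).removeNth (j.removeNth x))
    else 0

theorem ceBracketSum_succ (f : (Fin (n + 1) → L) → V) :
    ceBracketSum (n + 1) f = bracketSum (fun z w ↦ f (Fin.cons z w)) := rfl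

theorem bracketSum_cons_zero (ζ : L → (Fin 0 → L) → V) (y : L) (x : Fin 1 → L) :
    bracketSum ζ (Fin.cons y x : Fin 2 → L) = - uncurrySum (fun z w ↦ ζ ⁅y, z⁆ w) x := by
  simp [bracketSum, uncurrySum]
  congr 1

/-- The pairs containing position 0 give the first term. For the others both indices drop by one,
which preserves the sign (-1)^(i+j). -/
theorem bracketSum_cons (ζ : L → (Fin (n + 1) → L) → V) (y : L) (x : Fin (n + 2) → L) :
    bracketSum ζ (Fin.cons y x : Fin (n + 3) → L) =
      - uncurrySum (fun z w ↦ ζ ⁅y, z⁆ w) x + bracketSum (fun z w ↦ ζ z (Fin.cons y w)) x := by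
  rw [bracketSum, Fin.sum_univ_succ]
  congr 1
  · rw [Fin.sum_univ_succ]
    simp [uncurrySum, pow_succ, removeNth_succ_cons]
  · refine Finset.sum_congr rfl fun i _ ↦ ?_
    rw [Fin.sum_univ_succ]
    simp only [not_lt_zero, dite_false, zero_add]
    refine Finset.sum_congr rfl fun j _ ↦ ?_
    by_cases h : i < j
    · have e : (i.succ.castPred (Fin.ne_last_of_lt (Fin.succ_lt_succ_iff.2 h))) =
        (i.castPred (Fin.ne_last_of_lt h)).succ := by
        ext; simp
      simp only [Fin.succ_lt_succ_iff, h, dite_true, e, removeNth_succ_cons, Fin.cons_succ,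
        Fin.val_succ]
      congr 1
      rw [show (i : ℕ) + 1 + (j + 1) = i + j + 2 by ring, pow_add]; simp
    · simp [h]

theorem bracketSum_add (η θ : L → (Fin n → L) → V) :
    bracketSum (fun z w ↦ η z w + θ z w) = bracketSum η + bracketSum θ := by
  funext x
  simp only [bracketSum, Pi.add_apply, ← Finset.sum_add_distrib]
  refine Finset.sum_congr rfl fun i _ ↦ Finset.sum_congr rfl fun j _ ↦ ?_
  split_ifs <;> simp

theorem map_bracketSum (A : V →ₗ[ℝ] W) (η : L → (Fin n → L) → V) (x : Fin (n + 2) → L) :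
    A (bracketSum η x) = bracketSum (fun z w ↦ A (η z w)) x := by
  simp only [bracketSum, map_sum, apply_dite A, map_smul, map_zero]

theorem bracketSum_neg (η : L → (Fin n → L) → V) :
    bracketSum (fun z w ↦ - η z w) = - bracketSum η := by
  funext x
  exact (map_bracketSum (-LinearMap.id) η x).symm

theorem bracketSum_sub (η θ : L → (Fin n → L) → V) :
    bracketSum (fun z w ↦ η z w - θ z w) = bracketSum η - bracketSum θ := by
  simp only [sub_eq_add_neg]
  rw [bracketSum_add, bracketSum_neg]

/-- For i < j, the double sum contains Q(xᵢ, xⱼ) with sign (-1)^(i+j-1) and Q(xⱼ, xᵢ) with sign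
(-1)^(i+j), so only the commutator of `Q` survives. It serves for the commutator of a
representation, for the Jacobi identity and for the commutator of derivatives on the group. -/
theorem uncurrySum_uncurrySum (Q : L → L → (Fin n → L) → V) (ζ : L → (Fin n → L) → V)
    (h : ∀ a b w, Q a b w - Q b a w = ζ ⁅a, b⁆ w) :
    uncurrySum (fun a ↦ uncurrySum (Q a)) = - bracketSum ζ := by
  induction n with
  | zero =>
    funext x
    obtain ⟨y, x, rfl⟩ := exists_eq_fin_cons x
    obtain ⟨z, x, rfl⟩ := exists_eq_fin_cons x
    rw [Pi.neg_apply, bracketSum_cons_zero, uncurrySum_cons, uncurrySum_cons_zero,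
      uncurrySum_cons_zero, uncurrySum_cons_zero, uncurrySum_cons_zero, h, neg_neg]
  | succ n ih =>
    funext x
    obtain ⟨y, x, rfl⟩ := exists_eq_fin_cons x
    rw [Pi.neg_apply, bracketSum_cons, uncurrySum_cons]
    simp only [uncurrySum_cons]
    rw [uncurrySum_sub, ih (fun a b w ↦ Q a b (Fin.cons y w)) (fun a w ↦ ζ a (Fin.cons y w))
      (fun a b w ↦ h a b _)]
    simp only [← h, Pi.sub_apply, Pi.neg_apply]
    rw [uncurrySum_sub, Pi.sub_apply]
    abel

/-- The symmetrization Q(a, b) + Q(b, a) has zero commutator, so its double sum vanishes. -/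
theorem uncurrySum_uncurrySum_flip (Q : L → L → (Fin n → L) → V) :
    uncurrySum (fun a ↦ uncurrySum (Q a)) = - uncurrySum (fun a ↦ uncurrySum (fun b ↦ Q b a)) := by
  have h := uncurrySum_uncurrySum (fun a b w ↦ Q a b w + Q b a w) 0
    (fun a b w ↦ by simp [add_comm])
  have h0 : bracketSum (0 : L → (Fin n → L) → V) = 0 := by
    funext x; simp [bracketSum]
  simp only [uncurrySum_add] at h
  rw [h0, neg_zero] at h
  have h2 := uncurrySum_add (fun a ↦ uncurrySum (Q a)) (fun a ↦ uncurrySum (fun b ↦ Q b a))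
  exact eq_neg_of_add_eq_zero_left (h2.symm.trans h)

/-- Both sides run over a pair and a third position disjoint from it. Moving one variable past a
pair is an even permutation, so the order of extraction does not affect the sign. -/
theorem bracketSum_uncurrySum (κ : L → L → (Fin n → L) → V) :
    bracketSum (fun z ↦ uncurrySum (κ z)) =
      uncurrySum (fun a ↦ bracketSum (fun z ↦ κ z a)) := by
  induction n with
  | zero =>
    funext x
    obtain ⟨y, x, rfl⟩ := exists_eq_fin_cons x
    rw [bracketSum_cons, uncurrySum_cons]
    simp only [uncurrySum_cons_zero, bracketSum_cons_zero]
    rw [uncurrySum_uncurrySum_flip (fun z ↦ κ ⁅y, z⁆), uncurrySum_neg]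
    simp only [Pi.neg_apply]
    abel
  | succ n ih =>
    funext x
    obtain ⟨y, x, rfl⟩ := exists_eq_fin_cons x
    rw [bracketSum_cons, uncurrySum_cons]
    simp only [uncurrySum_cons, bracketSum_cons]
    rw [uncurrySum_uncurrySum_flip (fun z ↦ κ ⁅y, z⁆), uncurrySum_add, uncurrySum_neg,
      bracketSum_sub, ih (fun z a w ↦ κ z a (Fin.cons y w))]
    simp only [Pi.neg_apply, Pi.add_apply, Pi.sub_apply]
    abel

/-- Exchanging two disjoint pairs is an even permutation, so no sign appears. -/
theorem bracketSum_bracketSum_flip (κ : L → L → (Fin n → L) → V) :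
    bracketSum (fun z ↦ bracketSum (κ z)) = bracketSum (fun z ↦ bracketSum (fun a ↦ κ a z)) := by
  induction n with
  | zero =>
    funext x
    obtain ⟨y, x, rfl⟩ := exists_eq_fin_cons x
    rw [bracketSum_cons, bracketSum_cons]
    simp only [bracketSum_cons_zero]
    rw [bracketSum_neg, bracketSum_neg, bracketSum_uncurrySum (fun z b ↦ κ z ⁅y, b⁆),
      bracketSum_uncurrySum (fun z b w ↦ κ ⁅y, b⁆ z w)]
    simp only [Pi.neg_apply]
    abel
  | succ n ih =>
    funext x
    obtain ⟨y, x, rfl⟩ := exists_eq_fin_cons x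
    rw [bracketSum_cons, bracketSum_cons]
    simp only [bracketSum_cons]
    rw [bracketSum_add, bracketSum_add, bracketSum_neg, bracketSum_neg,
      bracketSum_uncurrySum (fun z b ↦ κ z ⁅y, b⁆),
      bracketSum_uncurrySum (fun z b w ↦ κ ⁅y, b⁆ z w), ih (fun z a w ↦ κ z a (Fin.cons y w))]
    simp only [Pi.neg_apply, Pi.add_apply]
    abel

theorem lie_lie_sub_lie_lie (y a b : L) : ⁅⁅y, a⁆, b⁆ - ⁅⁅y, b⁆, a⁆ = ⁅y, ⁅a, b⁆⁆ := by
  rw [lie_lie, ← lie_skew ⁅y, b⁆ a]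
  abel

/-- By the Jacobi identity, [y, [a, b]] is the commutator in a, b of [[y, a], b], so
`uncurrySum_uncurrySum` applies. -/
theorem bracketSum_lie_right (η : L → (Fin n → L) → V)
    (hη : ∀ a b w, η (a + b) w = η a w + η b w) (y : L) :
    bracketSum (fun z w ↦ η ⁅z, y⁆ w) =
      uncurrySum (fun a ↦ uncurrySum (fun b ↦ η ⁅⁅y, a⁆, b⁆)) := by
  have h0 : ∀ w, η 0 w = 0 := fun w ↦ by simpa using hη 0 0 w
  have hneg : ∀ a w, η (-a) w = - η a w := fun a w ↦
    eq_neg_of_add_eq_zero_left (by rw [← hη, neg_add_cancel, h0])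
  have hsub : ∀ a b w, η (a - b) w = η a w - η b w := fun a b w ↦ by
    rw [sub_eq_add_neg, hη, hneg, sub_eq_add_neg]
  rw [uncurrySum_uncurrySum (fun a b ↦ η ⁅⁅y, a⁆, b⁆) (fun z ↦ η ⁅y, z⁆)
    (fun a b w ↦ by rw [← hsub, lie_lie_sub_lie_lie]), ← bracketSum_neg]
  simp only [← hneg, lie_skew]

/-- The Jacobi identity summed over all triples of positions. The triples through the first variable
`y` give terms with `y` inside the inner bracket and terms with `y` outside it; these cancel by
`bracketSum_lie_right`, and induction covers the other triples. -/
theorem bracketSum_uncurrySum_lie (η : L → (Fin n → L) → V)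
    (hη : ∀ a b w, η (a + b) w = η a w + η b w) :
    bracketSum (fun z ↦ uncurrySum (fun a ↦ η ⁅z, a⁆)) = 0 := by
  induction n with
  | zero =>
    funext x
    obtain ⟨y, x, rfl⟩ := exists_eq_fin_cons x
    rw [bracketSum_cons]
    simp only [uncurrySum_cons_zero]
    rw [bracketSum_lie_right η hη y]
    simp
  | succ n ih =>
    funext x
    obtain ⟨y, x, rfl⟩ := exists_eq_fin_cons x
    rw [bracketSum_cons]
    simp only [uncurrySum_cons]
    rw [bracketSum_sub, bracketSum_lie_right η hη y, ih (fun a w ↦ η a (Fin.cons y w))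
      (fun a b w ↦ hη a b _)]
    simp

end BracketSum

/-! ### The Chevalley-Eilenberg complex. -/

section ChevalleyEilenberg

variable {L V W : Type u} [LieRing L] [LieAlgebra ℝ L] [AddCommGroup V] [Module ℝ V]
  [AddCommGroup W] [Module ℝ W] {n : ℕ}

theorem ceDifferential_apply (ρ : L →ₗ⁅ℝ⁆ Module.End ℝ V) (f : (Fin n → L) → V) :
    ceDifferential ρ n f = uncurrySum (fun z w ↦ ρ z (f w)) + ceBracketSum n f := rfl

theorem uncurrySum_mem_ceCochains (η : L → (Fin n → L) → V) (hη : ∀ z, η z ∈ ceCochains L V n)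
    (hadd : ∀ a b, η (a + b) = η a + η b) (hsmul : ∀ (r : ℝ) a, η (r • a) = r • η a) :
    uncurrySum η ∈ ceCochains L V (n + 1) := by
  choose a ha using hη
  let A : L →ₗ[ℝ] L [⋀^Fin n]→ₗ[ℝ] V :=
    { toFun := a
      map_add' := fun x y ↦ DFunLike.coe_injective (by
        rw [ha, hadd, ← ha, ← ha]; rfl)
      map_smul' := fun r x ↦ DFunLike.coe_injective (by
        rw [ha, hsmul, ← ha]; rfl) }
  refine ⟨AlternatingMap.alternatizeUncurryFin A, funext fun x ↦ ?_⟩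
  rw [AlternatingMap.alternatizeUncurryFin_apply]
  refine Finset.sum_congr rfl fun i _ ↦ ?_
  change _ • a (x i) _ = _
  rw [ha]
  -- `alternatizeUncurryFin` uses integer signs and `uncurrySum` real ones; they agree by parity.
  rcases neg_one_pow_eq_or ℤ (i : ℕ) with h | h <;>
  rcases Nat.even_or_odd (i : ℕ) with h' | h' <;> simp [h'.neg_one_pow]

theorem bracketSum_mem_ceCochains (ζ : L → (Fin n → L) → V) (hζ : ∀ z, ζ z ∈ ceCochains L V n)
    (hadd : ∀ a b, ζ (a + b) = ζ a + ζ b) (hsmul : ∀ (r : ℝ) a, ζ (r • a) = r • ζ a) :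
    bracketSum ζ ∈ ceCochains L V (n + 2) := by
  have hneg : ∀ a, ζ (-a) = - ζ a := fun a ↦ by simpa using hsmul (-1) a
  -- The commutator of ½ ζ([a, b]) is ζ([a, b]). So the bracket sum is, up to sign, a double
  -- `uncurrySum`, and alternation follows from the previous lemma.
  have h := uncurrySum_uncurrySum (fun a b ↦ (2⁻¹ : ℝ) • ζ ⁅a, b⁆) ζ (fun a b w ↦ by
    rw [← lie_skew b a, hneg]
    simp only [Pi.smul_apply, Pi.neg_apply, smul_neg, sub_neg_eq_add, ← add_smul]
    norm_num)
  rw [← neg_eq_iff_eq_neg] at h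
  rw [← h]
  refine Submodule.neg_mem _ (uncurrySum_mem_ceCochains _ (fun a ↦ ?_) (fun a b ↦ ?_) fun r a ↦ ?_)
  · refine uncurrySum_mem_ceCochains _ (fun b ↦ Submodule.smul_mem _ _ (hζ _)) (fun b c ↦ ?_)
      (fun r b ↦ ?_)
    · rw [lie_add, hadd, smul_add]
    · rw [lie_smul, hsmul, smul_comm]
  · rw [← uncurrySum_add]
    simp only [add_lie, hadd, smul_add, Pi.smul_apply]
    rfl
  · rw [← uncurrySum_smul]
    simp only [smul_lie, hsmul, smul_comm (2⁻¹ : ℝ) r]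
    rfl

theorem ceCochains_cons_add {f : (Fin (n + 1) → L) → V} (hf : f ∈ ceCochains L V (n + 1)) (a b : L)
    (w : Fin n → L) : f (Fin.cons (a + b) w) = f (Fin.cons a w) + f (Fin.cons b w) := by
  obtain ⟨f, rfl⟩ := hf
  exact f.toMultilinearMap.cons_add w a b

theorem ceCochains_cons_smul {f : (Fin (n + 1) → L) → V} (hf : f ∈ ceCochains L V (n + 1)) (r : ℝ)
    (a : L) (w : Fin n → L) : f (Fin.cons (r • a) w) = r • f (Fin.cons a w) := by
  obtain ⟨f, rfl⟩ := hf
  exact f.toMultilinearMap.cons_smul w r a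

theorem ceCochains_cons_mem {f : (Fin (n + 1) → L) → V} (hf : f ∈ ceCochains L V (n + 1)) (a : L) :
    (fun w ↦ f (Fin.cons a w)) ∈ ceCochains L V n := by
  obtain ⟨f, rfl⟩ := hf
  exact ⟨f.curryLeft a, rfl⟩

theorem ceCochains_cons_swap {f : (Fin (n + 2) → L) → V} (hf : f ∈ ceCochains L V (n + 2)) (a b : L)
    (w : Fin n → L) : f (Fin.cons a (Fin.cons b w : Fin (n + 1) → L)) =
      - f (Fin.cons b (Fin.cons a w : Fin (n + 1) → L)) := by
  obtain ⟨f, rfl⟩ := hf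
  rw [← f.map_swap (v := (Fin.cons b (Fin.cons a w : Fin (n + 1) → L))) (i := 0) (j := 1) (by simp)]
  congr 1
  funext i
  refine Fin.cases (by simp) (fun i ↦ Fin.cases (by simp) (fun i ↦ ?_) i) i
  rw [Function.comp, Equiv.swap_apply_of_ne_of_ne (Fin.succ_ne_zero _)]
  · simp
  · exact fun h ↦ Fin.succ_ne_zero i (Fin.succ_injective _ h)

theorem map_comp_mem_ceCochains (A : V →ₗ[ℝ] W) {f : (Fin n → L) → V} (hf : f ∈ ceCochains L V n) :
    (fun w ↦ A (f w)) ∈ ceCochains L W n := by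
  obtain ⟨f, rfl⟩ := hf
  exact ⟨A.compAlternatingMap f, rfl⟩

theorem ceDifferential_mem_ceCochains (ρ : L →ₗ⁅ℝ⁆ Module.End ℝ V) {f : (Fin n → L) → V}
    (hf : f ∈ ceCochains L V n) : ceDifferential ρ n f ∈ ceCochains L V (n + 1) := by
  rw [ceDifferential_apply]
  refine Submodule.add_mem _ (uncurrySum_mem_ceCochains _ (fun z ↦ map_comp_mem_ceCochains _ hf)
    (fun a b ↦ ?_) (fun r a ↦ ?_)) ?_
  · funext w; simp
  · funext w; simp
  · cases n with
    | zero => exact Submodule.zero_mem _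
    | succ n =>
      rw [ceBracketSum_succ]
      exact bracketSum_mem_ceCochains _ (fun z ↦ ceCochains_cons_mem hf z)
        (fun a b ↦ funext fun w ↦ ceCochains_cons_add hf a b w)
        (fun r a ↦ funext fun w ↦ ceCochains_cons_smul hf r a w)

theorem uncurrySum_rep_uncurrySum_rep (ρ : L →ₗ⁅ℝ⁆ Module.End ℝ V) (f : (Fin n → L) → V) :
    uncurrySum (fun z w ↦ ρ z (uncurrySum (fun z w ↦ ρ z (f w)) w)) =
      - bracketSum (fun z w ↦ ρ z (f w)) := by
  simp only [map_uncurrySum]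
  refine uncurrySum_uncurrySum (fun a b w ↦ ρ a (ρ b (f w))) _ (fun a b w ↦ ?_)
  rw [LieHom.map_lie, LieRing.of_associative_ring_bracket]
  rfl

/-- The bracket [xᵢ, xⱼ] sits in first position: either it is the variable extracted by
`uncurrySum`, or it remains among the arguments of the cochain. -/
theorem bracketSum_cons_uncurrySum (η : L → (Fin (n + 1) → L) → V) :
    bracketSum (fun z w ↦ uncurrySum η (Fin.cons z w : Fin (n + 2) → L)) =
      bracketSum η - uncurrySum (fun a ↦ bracketSum (fun z w ↦ η a (Fin.cons z w))) := by
  simp only [uncurrySum_cons]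
  rw [bracketSum_sub, bracketSum_uncurrySum (fun z a w ↦ η a (Fin.cons z w))]

/-- Nested brackets [[xᵢ, xⱼ], xₖ] cancel by Jacobi. Two brackets of disjoint pairs cancel because
the sum is symmetric in the pairs while `f` is alternating. -/
theorem ceBracketSum_ceBracketSum {f : (Fin (n + 1) → L) → V} (hf : f ∈ ceCochains L V (n + 1)) :
    ceBracketSum (n + 2) (ceBracketSum (n + 1) f) = 0 := by
  rw [ceBracketSum_succ, ceBracketSum_succ]
  have h := bracketSum_uncurrySum_lie (fun z w ↦ f (Fin.cons z w)) (ceCochains_cons_add hf)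
  cases n with
  | zero =>
    simp only [bracketSum_cons_zero]
    rw [bracketSum_neg, h, neg_zero]
  | succ n =>
    simp only [bracketSum_cons]
    rw [bracketSum_add, bracketSum_neg, h, neg_zero, zero_add]
    have h2 := bracketSum_bracketSum_flip
      (fun a b w ↦ f (Fin.cons b (Fin.cons a w : Fin (n + 1) → L)))
    have h3 : (fun a b w ↦ f (Fin.cons b (Fin.cons a w : Fin (n + 1) → L))) =
        (fun a b w ↦ - f (Fin.cons a (Fin.cons b w : Fin (n + 1) → L))) := by
      funext a b w; exact ceCochains_cons_swap hf _ _ _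
    have h4 : ∀ z, bracketSum (fun a w ↦ f (Fin.cons z (Fin.cons a w : Fin (n + 1) → L))) =
        - bracketSum (fun a w ↦ f (Fin.cons a (Fin.cons z w : Fin (n + 1) → L))) := fun z ↦ by
      rw [← bracketSum_neg]
      simp only [ceCochains_cons_swap hf z]
    simp only [h4] at h2
    have h5 := bracketSum_neg
      (fun z ↦ bracketSum (fun a w ↦ f (Fin.cons a (Fin.cons z w : Fin (n + 1) → L))))
    have h6 := h2.trans h5
    funext x
    -- Symmetry in the two pairs and the sign from alternation make the sum equal to its own
    -- negative.
    have h7 : (2 : ℝ) • bracketSum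
      (fun z ↦ bracketSum (fun a w ↦ f (Fin.cons a (Fin.cons z w : Fin (n + 1) → L)))) x = 0 := by
      rw [two_smul]
      exact eq_neg_iff_add_eq_zero.1 (congrFun h6 x)
    exact (smul_eq_zero.1 h7).resolve_left two_ne_zero

theorem ceBracketSum_add (f g : (Fin n → L) → V) :
    ceBracketSum n (f + g) = ceBracketSum n f + ceBracketSum n g := by
  cases n with
  | zero => exact (add_zero 0).symm
  | succ n => exact bracketSum_add (fun z w ↦ f (Fin.cons z w)) (fun z w ↦ g (Fin.cons z w))

/-- The square of the representation part is minus a bracket sum of ρ, which reappears with a plus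
sign when the bracket part is applied to the representation part. The remaining mixed terms cancel,
and the bracket part squares to zero. -/
theorem ceDifferential_ceDifferential (ρ : L →ₗ⁅ℝ⁆ Module.End ℝ V) {f : (Fin n → L) → V}
    (hf : f ∈ ceCochains L V n) : ceDifferential ρ (n + 1) (ceDifferential ρ n f) = 0 := by
  rw [ceDifferential_apply ρ (ceDifferential ρ n f), ceDifferential_apply, ceBracketSum_add]
  simp only [Pi.add_apply, map_add]
  rw [uncurrySum_add, uncurrySum_rep_uncurrySum_rep]
  cases n with
  | zero =>
    rw [ceBracketSum_succ]
    simp only [uncurrySum_cons_zero]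
    funext x
    simp [ceBracketSum, uncurrySum]
  | succ n =>
    rw [ceBracketSum_ceBracketSum hf, ceBracketSum_succ, ceBracketSum_succ,
      bracketSum_cons_uncurrySum]
    simp only [map_bracketSum]
    abel

end ChevalleyEilenberg

/-! ### Decomposition of a sum over permutations by the image of 0. -/

section Permutations

variable {L V : Type u} [AddCommGroup V] [Module ℝ V] {n : ℕ}

theorem sum_perm_succ (F : (Fin (n + 1) → L) → V) (x : Fin (n + 1) → L) :
    ∑ σ : Equiv.Perm (Fin (n + 1)), ((Equiv.Perm.sign σ : ℤ) : ℝ) • F (x ∘ σ) =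
      uncurrySum (fun z w ↦ ∑ σ : Equiv.Perm (Fin n), ((Equiv.Perm.sign σ : ℤ) : ℝ) •
        F (Fin.cons z (w ∘ σ))) x := by
  -- The pair (i, σ) becomes the permutation sending 0 to i and k + 1 to `i.succAbove (σ k)`. The
  -- cycle contributes the sign (-1)^i.
  let e : Fin (n + 1) × Equiv.Perm (Fin n) → Equiv.Perm (Fin (n + 1)) := fun p ↦
    p.1.cycleRange.symm * Equiv.Perm.decomposeFin.symm (0, p.2)
  have e0 : ∀ p, e p 0 = p.1 := fun p ↦ by simp [e]
  have es : ∀ p (k : Fin n), e p k.succ = p.1.succAbove (p.2 k) := fun p k ↦ by simp [e]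
  have hinj : Function.Injective e := by
    rintro ⟨i, σ⟩ ⟨j, τ⟩ h
    obtain rfl : i = j := (e0 (i, σ)).symm.trans ((congrArg (· 0) h).trans (e0 (j, τ)))
    refine Prod.ext rfl (Equiv.ext fun k ↦ Fin.succAbove_right_injective (p := i) ?_)
    exact (es (i, σ) k).symm.trans ((congrArg (· k.succ) h).trans (es (i, τ) k))
  have hbij : Function.Bijective e :=
    (Fintype.bijective_iff_injective_and_card e).2 ⟨hinj, by
      simp [Fintype.card_perm, Nat.factorial_succ]⟩
  rw [← hbij.sum_comp, Fintype.sum_prod_type]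
  refine Finset.sum_congr rfl fun i _ ↦ ?_
  rw [Finset.smul_sum]
  refine Finset.sum_congr rfl fun σ _ ↦ ?_
  have h1 : x ∘ e (i, σ) = Fin.cons (x i) (i.removeNth x ∘ σ) := by
    funext k
    refine Fin.cases ?_ (fun k ↦ ?_) k
    · simp [e0]
    · simp [es, Fin.removeNth_apply]
  have h2 : Equiv.Perm.sign (e (i, σ)) = (-1) ^ (i : ℕ) * Equiv.Perm.sign σ := by
    simp [e, Fin.sign_cycleRange, Equiv.Perm.decomposeFin.symm_sign]
  rw [h1, h2, smul_smul]
  simp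

end Permutations

/-! ### The group complex and its normalized cochains. -/

section GroupCohomology

variable {G V W : Type u} [Group G] [AddCommGroup V] [Module ℝ V] [AddCommGroup W] [Module ℝ W]
  {n : ℕ}

theorem groupDifferential_apply (ρ : Representation ℝ G V) (f : (Fin n → G) → V)
    (g : Fin (n + 1) → G) : groupDifferential ρ n f g = ρ (g 0) (f (Fin.tail g)) +
    ∑ i : Fin n, (-1 : ℝ) ^ ((i : ℕ) + 1) • f (Fin.contractNth i.castSucc (· * ·) g) +
    (-1 : ℝ) ^ (n + 1) • f (Fin.init g) := rfl

theorem groupDifferential_groupDifferential (ρ : Representation ℝ G V) (f : (Fin n → G) → V) :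
    groupDifferential ρ (n + 1) (groupDifferential ρ n f) = 0 := by
  -- The identity δ² = 0 is taken from `inhomogeneousCochains`; scalars are lifted to the universe
  -- of `G` and `V`.
  let ρ' : Representation (ULift.{u} ℝ) G V :=
    { toFun g :=
        { toFun := ρ g
          map_add' := map_add _
          map_smul' := fun r v ↦ (ρ g).map_smul r.down v }
      map_one' := by ext v; simp
      map_mul' g h := by ext v; simp }
  have hd : ∀ m (f : (Fin m → G) → V),
      (inhomogeneousCochains.d (Rep.of ρ') m).hom f = groupDifferential ρ m f := by
    intro m f
    funext g
    rw [inhomogeneousCochains.d_hom_apply, groupDifferential_apply, Fin.sum_univ_castSucc, add_assoc]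
    have hs : ∀ (k : ℕ) (v : V), (-1 : ULift.{u} ℝ) ^ k • v = (-1 : ℝ) ^ k • v := fun k v ↦ by
      rcases Nat.even_or_odd k with hk | hk <;> simp [hk.neg_one_pow]
    have hl : Fin.contractNth (Fin.last m) (· * ·) g = Fin.init g := by
      funext k
      simp [Fin.contractNth, Fin.init]
    simp only [hs, hl]
    rfl
  have h := congrArg (fun φ ↦ φ.hom f)
    (groupCohomology.inhomogeneousCochains.d_comp_d (n := n) (Rep.of ρ'))
  simp only [ModuleCat.hom_comp, LinearMap.comp_apply, hd] at h
  exact h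

theorem contractNth_zero_cons (a : G) (g : Fin (n + 1) → G) :
    Fin.contractNth 0 (· * ·) (Fin.cons a g : Fin (n + 2) → G) =
      (Fin.cons (a * g 0) (Fin.tail g) : Fin (n + 1) → G) := by
  funext k
  refine Fin.cases ?_ (fun k ↦ ?_) k
  · simp [Fin.contractNth]
  · simp [Fin.contractNth, Fin.tail]

theorem contractNth_succ_cons (i : Fin (n + 1)) (a : G) (g : Fin (n + 1) → G) :
    Fin.contractNth i.succ (· * ·) (Fin.cons a g : Fin (n + 2) → G) =
      (Fin.cons a (Fin.contractNth i (· * ·) g) : Fin (n + 1) → G) := by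
  funext k
  refine Fin.cases ?_ (fun k ↦ ?_) k
  · simp [Fin.contractNth]
  · simp [Fin.contractNth]

/-- All terms that leave `a` alone in the first slot are those of minus the differential of `f (a,
·)`, except its leading term ρ(g₀) f(a, tail g), which is added back. -/
theorem groupDifferential_cons (ρ : Representation ℝ G V) (f : (Fin (n + 1) → G) → V) (a : G)
    (g : Fin (n + 1) → G) :
    groupDifferential ρ (n + 1) f (Fin.cons a g : Fin (n + 2) → G) =
      ρ a (f g) - f (Fin.cons (a * g 0) (Fin.tail g)) +
        ρ (g 0) (f (Fin.cons a (Fin.tail g))) -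
        groupDifferential ρ n (fun h ↦ f (Fin.cons a h)) g := by
  rw [groupDifferential_apply, groupDifferential_apply, Fin.sum_univ_succ]
  simp only [Fin.cons_zero, Fin.tail_cons, Fin.castSucc_zero, contractNth_zero_cons]
  have h1 : (Fin.init (Fin.cons a g : Fin (n + 2) → G) : Fin (n + 1) → G) =
      Fin.cons a (Fin.init g) := by
    funext k
    refine Fin.cases ?_ (fun k ↦ ?_) k <;> simp [Fin.init]
  have h2 : ∀ i : Fin n, Fin.contractNth i.succ.castSucc (· * ·) (Fin.cons a g : Fin (n + 2) → G) =
      (Fin.cons a (Fin.contractNth i.castSucc (· * ·) g) : Fin (n + 1) → G) := fun i ↦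
    contractNth_succ_cons i.castSucc a g
  simp only [h1, h2, Fin.val_succ, pow_succ _ (_ + 1), mul_neg_one, neg_smul,
    Finset.sum_neg_distrib]
  simp
  abel

theorem groupDifferential_map (ρ : Representation ℝ G V) (σ : Representation ℝ G W)
    (A : V →ₗ[ℝ] W) (hA : ∀ g v, A (ρ g v) = σ g (A v)) (f : (Fin n → G) → V) :
    groupDifferential σ n (fun g ↦ A (f g)) = fun g ↦ A (groupDifferential ρ n f g) := by
  funext g
  simp only [groupDifferential_apply, map_add, hA, map_sum, map_smul]

theorem groupDifferential_comp {H : Type u} [Group H] (σ : Representation ℝ H W) (Φ : G →* H)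
    (f : (Fin n → H) → W) :
    groupDifferential (σ.comp Φ) n (fun g ↦ f (Φ ∘ g)) = fun g ↦ groupDifferential σ n f (Φ ∘ g) := by
  funext g
  have h : ∀ i : Fin n, (Φ ∘ Fin.contractNth i.castSucc (· * ·) g : Fin n → H) =
      Fin.contractNth i.castSucc (· * ·) (Φ ∘ g) := fun i ↦ by
    funext k
    simp only [Fin.contractNth, Function.comp]
    split_ifs <;> simp
  simp only [groupDifferential_apply, h]
  rfl

/-- Induction through `groupDifferential_cons`. A 1 in the first slot makes ρ(a) f(g) cancel the
product term; a 1 in the second makes the product term cancel ρ(g₀) f(a, tail g); further to the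
right, every term vanishes separately. -/
theorem groupDifferential_eq_zero (ρ : Representation ℝ G V) {f : (Fin n → G) → V}
    (hf : ∀ g, (∃ i, g i = 1) → f g = 0) (g : Fin (n + 1) → G) (hg : ∃ i, g i = 1) :
    groupDifferential ρ n f g = 0 := by
  induction n with
  | zero =>
    obtain ⟨i, hi⟩ := hg
    obtain rfl := Fin.fin_one_eq_zero i
    rw [groupDifferential_apply, hi, Subsingleton.elim (Fin.init g) (Fin.tail g)]
    simp
  | succ n ih =>
    obtain ⟨a, h, rfl⟩ := exists_eq_fin_cons g
    have hcons : ∀ (b : G) (k : Fin n → G), (∃ i, k i = 1) →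
        f (Fin.cons b k : Fin (n + 1) → G) = 0 := fun b k ⟨i, hi⟩ ↦ hf _ ⟨i.succ, by simpa using hi⟩
    rw [groupDifferential_cons]
    obtain ⟨i, hi⟩ := hg
    induction i using Fin.cases with
    | zero =>
      obtain rfl : a = 1 := by simpa using hi
      have h0 : (fun k ↦ f (Fin.cons 1 k : Fin (n + 1) → G)) = 0 :=
        funext fun k ↦ hf _ ⟨0, by simp⟩
      rw [h0, hf (Fin.cons 1 (Fin.tail h)) ⟨0, by simp⟩]
      simp
    | succ i =>
      have hi' : h i = 1 := by simpa using hi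
      rw [ih (hcons a) h ⟨i, hi'⟩, hf h ⟨i, hi'⟩]
      induction i using Fin.cases with
      | zero => simp [hi']
      | succ i => rw [hcons _ _ ⟨i, hi'⟩, hcons _ _ ⟨i, hi'⟩]; simp

end GroupCohomology

/-! ### Smooth maps on products, and derivatives depending on a parameter. -/

section Smooth

variable {E F V W : Type*} [NormedAddCommGroup E] [NormedSpace ℝ E]
  [NormedAddCommGroup F] [NormedSpace ℝ F]
  [NormedAddCommGroup V] [NormedSpace ℝ V] [NormedAddCommGroup W] [NormedSpace ℝ W]
  {G : Type*} [TopologicalSpace G] [ChartedSpace E G]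
  {B : Type*} [TopologicalSpace B] {J : ModelWithCorners ℝ F B}
  {N : Type*} [TopologicalSpace N] [ChartedSpace B N] {n : ℕ}

instance boundaryless_pi :
    (ModelWithCorners.pi fun _ : Fin n ↦ 𝓘(ℝ, E)).Boundaryless where
  range_eq_univ := Set.range_eq_univ.2 fun x ↦ ⟨x, rfl⟩

theorem contMDiff_into_pi {φ : N → Fin n → G} (h : ∀ i, ContMDiff J 𝓘(ℝ, E) ∞ (fun x ↦ φ x i)) :
    ContMDiff J (ModelWithCorners.pi fun _ : Fin n ↦ 𝓘(ℝ, E)) ∞ φ := by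
  intro x
  refine contMDiffAt_iff_target.2 ⟨(continuous_pi fun i ↦ (h i).continuous).continuousAt, ?_⟩
  exact contMDiffAt_pi_space.2 fun i ↦ (contMDiffAt_iff_target.1 (h i x)).2

theorem contMDiff_eval (i : Fin n) :
    ContMDiff (ModelWithCorners.pi fun _ : Fin n ↦ 𝓘(ℝ, E)) 𝓘(ℝ, E) ∞ (fun x : Fin n → G ↦ x i) := by
  intro x
  refine contMDiffAt_iff.2 ⟨(continuous_apply i).continuousAt, ?_⟩
  have h1 : ContDiff ℝ ∞ (fun s : Fin n → E ↦ s i) := contDiff_apply ℝ E i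
  refine h1.contDiffWithinAt.congr_of_eventuallyEq ?_ ?_
  · refine Filter.Eventually.filter_mono nhdsWithin_le_nhds ?_
    have h2 := (continuous_apply (A := fun _ : Fin n ↦ E) i).continuousAt.preimage_mem_nhds
      (x := extChartAt (ModelWithCorners.pi fun _ : Fin n ↦ 𝓘(ℝ, E)) x x)
      (extChartAt_target_mem_nhds (I := 𝓘(ℝ, E)) (x i))
    filter_upwards [h2] with s hs
    exact (extChartAt 𝓘(ℝ, E) (x i)).right_inv hs
  · exact (extChartAt 𝓘(ℝ, E) (x i)).right_inv (mem_extChartAt_target (x i))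

/-- A function on a product, read in the preferred charts at a point. -/
theorem contDiffAt_chart_prod [J.Boundaryless] {K : N → G → V}
    (hK : ContMDiff (J.prod 𝓘(ℝ, E)) 𝓘(ℝ, V) ∞ (Function.uncurry K)) (x : N) (y : G) :
    ContDiffAt ℝ ∞ (fun p : F × E ↦ K ((extChartAt J x).symm p.1) ((extChartAt 𝓘(ℝ, E) y).symm p.2))
      (extChartAt J x x, extChartAt 𝓘(ℝ, E) y y) := by
  have h := (contMDiffAt_iff.1 (hK (x, y))).2
  rw [ModelWithCorners.range_eq_univ, contDiffWithinAt_univ] at h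
  exact h

theorem mdifferentiableAt_right [J.Boundaryless] {K : N → G → V}
    (hK : ContMDiff (J.prod 𝓘(ℝ, E)) 𝓘(ℝ, V) ∞ (Function.uncurry K)) (x : N) (y : G) :
    MDifferentiableAt 𝓘(ℝ, E) 𝓘(ℝ, V) (K x) y :=
  ContMDiff.mdifferentiableAt (n := ∞)
    (hK.comp ((contMDiff_const (c := x)).prodMk contMDiff_id)) (by simp)

/-- In a fixed chart at `y` the directional derivative is an ordinary partial derivative, and
partial derivatives of a smooth function depend smoothly on the parameter. -/
theorem contMDiff_dirDeriv [J.Boundaryless] {K : N → G → V}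
    (hK : ContMDiff (J.prod 𝓘(ℝ, E)) 𝓘(ℝ, V) ∞ (Function.uncurry K)) (y : G)
    (X : TangentSpace 𝓘(ℝ, E) y) : ContMDiff J 𝓘(ℝ, V) ∞ (fun x ↦ dirDeriv (K x) y X) := by
  have e : (fun x ↦ dirDeriv (K x) y X) = fun x ↦ fderiv ℝ
      (fun s ↦ K x ((extChartAt 𝓘(ℝ, E) y).symm s)) (extChartAt 𝓘(ℝ, E) y y) (X : E) :=
    funext fun x ↦ mfderiv_eq_fderiv_chart (mdifferentiableAt_right hK x y) X
  rw [e]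
  intro x
  have h := contDiffAt_chart_prod hK x y
  have h2 : ContDiffAt ℝ ∞ (fun s : F ↦ fderiv ℝ (fun t : E ↦ K ((extChartAt J x).symm s)
      ((extChartAt 𝓘(ℝ, E) y).symm t)) (extChartAt 𝓘(ℝ, E) y y)) (extChartAt J x x) :=
    ContDiffAt.fderiv (n := ∞) (f := fun s t ↦ K ((extChartAt J x).symm s)
      ((extChartAt 𝓘(ℝ, E) y).symm t)) (by exact h) contDiffAt_const (by simp)
  have h3 : ContDiffAt ℝ ∞ (fun s : F ↦ fderiv ℝ (fun t : E ↦ K ((extChartAt J x).symm s)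
      ((extChartAt 𝓘(ℝ, E) y).symm t)) (extChartAt 𝓘(ℝ, E) y y) (X : E)) (extChartAt J x x) :=
    h2.clm_apply contDiffAt_const
  refine contMDiffAt_iff.2 ⟨?_, ?_⟩
  -- Continuity on the manifold is recovered from the chart expression, since chart and inverse
  -- chart cancel near `x`.
  · have hc := h3.continuousAt.comp_of_eq (continuousAt_extChartAt (I := J) x) rfl
    refine hc.congr ?_
    filter_upwards [extChartAt_source_mem_nhds (I := J) x] with z hz
    simp only [Function.comp, (extChartAt J x).left_inv hz]
  · exact h3.contDiffWithinAt

/-- Both sides are the second derivative of `K` on the vectors (X, 0) and (0, Y), which is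
symmetric. -/
theorem fderiv_fderiv_comm {K : E × F → V} {p : E} {q : F} (hK : ContDiffAt ℝ ∞ K (p, q))
    (X : E) (Y : F) :
    fderiv ℝ (fun t ↦ fderiv ℝ (fun s ↦ K (s, t)) p X) q Y =
      fderiv ℝ (fun s ↦ fderiv ℝ (fun t ↦ K (s, t)) q Y) p X := by
  have h1 : ∀ᶠ z in nhds (p, q), DifferentiableAt ℝ K z := by
    have := (hK.of_le (m := 1) (by norm_cast)).eventually (by simp)
    filter_upwards [this] with z hz using hz.differentiableAt (by simp)
  have hd : DifferentiableAt ℝ (fderiv ℝ K) (p, q) :=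
    (hK.fderiv_right (m := 1) (by norm_cast)).differentiableAt (by simp)
  have hl : ∀ t : F, HasFDerivAt (fun s : E ↦ (s, t)) (ContinuousLinearMap.inl ℝ E F) p :=
    fun t ↦ hasFDerivAt_prodMk_left p t
  have hr : ∀ s : E, HasFDerivAt (fun t : F ↦ (s, t)) (ContinuousLinearMap.inr ℝ E F) q :=
    fun s ↦ hasFDerivAt_prodMk_right s q
  have e1 : (fun t ↦ fderiv ℝ (fun s ↦ K (s, t)) p X) =ᶠ[nhds q]
      fun t ↦ fderiv ℝ K (p, t) (X, 0) := by
    have := (hr p).continuousAt.eventually h1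
    filter_upwards [this] with t ht
    have h := (ht.hasFDerivAt.comp p (hl t)).fderiv
    exact congrArg (· X) h
  have e2 : (fun s ↦ fderiv ℝ (fun t ↦ K (s, t)) q Y) =ᶠ[nhds p]
      fun s ↦ fderiv ℝ K (s, q) (0, Y) := by
    have := (hl q).continuousAt.eventually h1
    filter_upwards [this] with s hs
    have h := (hs.hasFDerivAt.comp q (hr s)).fderiv
    exact congrArg (· Y) h
  rw [e1.fderiv_eq, e2.fderiv_eq]
  have d1 := ((hd.hasFDerivAt.comp q (hr p)).clm_apply (hasFDerivAt_const ((X, 0) : E × F) q)).fderiv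
  have d2 := ((hd.hasFDerivAt.comp p (hl q)).clm_apply (hasFDerivAt_const ((0, Y) : E × F) p)).fderiv
  have d1' := congrArg (· Y) d1
  have d2' := congrArg (· X) d2
  simp at d1' d2'
  have hs : IsSymmSndFDerivAt ℝ K (p, q) := hK.isSymmSndFDerivAt (by simp; norm_cast)
  exact d1'.trans ((hs _ _).trans d2'.symm)

theorem dirDeriv_dirDeriv_comm {K : G → G → V}
    (hK : ContMDiff (𝓘(ℝ, E).prod 𝓘(ℝ, E)) 𝓘(ℝ, V) ∞ (Function.uncurry K)) (x y : G)
    (X : TangentSpace 𝓘(ℝ, E) x) (Y : TangentSpace 𝓘(ℝ, E) y) :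
    dirDeriv (fun b ↦ dirDeriv (fun a ↦ K a b) x X) y Y =
      dirDeriv (fun a ↦ dirDeriv (K a) y Y) x X := by
  have hK' : ContMDiff (𝓘(ℝ, E).prod 𝓘(ℝ, E)) 𝓘(ℝ, V) ∞ (Function.uncurry fun b a ↦ K a b) :=
    hK.comp (contMDiff_snd.prodMk contMDiff_fst)
  rw [mfderiv_eq_fderiv_chart ((contMDiff_dirDeriv hK' x X).mdifferentiableAt (by simp)),
    mfderiv_eq_fderiv_chart ((contMDiff_dirDeriv hK y Y).mdifferentiableAt (by simp))]
  have e1 : ∀ b, dirDeriv (fun a ↦ K a b) x X = fderiv ℝ (fun s ↦ K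
      ((extChartAt 𝓘(ℝ, E) x).symm s) b) (extChartAt 𝓘(ℝ, E) x x) (X : E) := fun b ↦
    mfderiv_eq_fderiv_chart (mdifferentiableAt_right hK' b x) X
  have e2 : ∀ a, dirDeriv (fun b ↦ K a b) y Y = fderiv ℝ (fun t ↦ K a
      ((extChartAt 𝓘(ℝ, E) y).symm t)) (extChartAt 𝓘(ℝ, E) y y) (Y : E) := fun a ↦
    mfderiv_eq_fderiv_chart (mdifferentiableAt_right hK a y) Y
  simp only [e1, e2]
  exact fderiv_fderiv_comm (contDiffAt_chart_prod hK x y) X Y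

theorem dirDeriv_add {f g : G → V} {x : G} (hf : MDifferentiableAt 𝓘(ℝ, E) 𝓘(ℝ, V) f x)
    (hg : MDifferentiableAt 𝓘(ℝ, E) 𝓘(ℝ, V) g x) (X : TangentSpace 𝓘(ℝ, E) x) :
    dirDeriv (fun a ↦ f a + g a) x X = dirDeriv f x X + dirDeriv g x X :=
  congrArg (fun T : E →L[ℝ] V ↦ T X) (hf.hasMFDerivAt.add hg.hasMFDerivAt).mfderiv

theorem dirDeriv_clm (A : V →L[ℝ] W) {f : G → V} {x : G}
    (hf : MDifferentiableAt 𝓘(ℝ, E) 𝓘(ℝ, V) f x) (X : TangentSpace 𝓘(ℝ, E) x) :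
    dirDeriv (fun a ↦ A (f a)) x X = A (dirDeriv f x X) :=
  congrArg (fun T : E →L[ℝ] W ↦ T X) (A.hasMFDerivAt.comp x hf.hasMFDerivAt).mfderiv

theorem dirDeriv_const (c : V) (x : G) (X : TangentSpace 𝓘(ℝ, E) x) :
    dirDeriv (fun _ : G ↦ c) x X = 0 :=
  congrArg (fun T : E →L[ℝ] V ↦ T X) (hasMFDerivAt_const c x).mfderiv

end Smooth

/-! ### The Lie bracket as a commutator of derivatives at the identity. -/

section LieBracket

variable {E V : Type*} [NormedAddCommGroup E] [NormedSpace ℝ E]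
  [NormedAddCommGroup V] [NormedSpace ℝ V]
  {G : Type*} [TopologicalSpace G] [ChartedSpace E G] [Group G] [LieGroup 𝓘(ℝ, E) ∞ G]

theorem contMDiff_uncurry_mul {f : G → V} (hf : ContMDiff 𝓘(ℝ, E) 𝓘(ℝ, V) ∞ f) :
    ContMDiff (𝓘(ℝ, E).prod 𝓘(ℝ, E)) 𝓘(ℝ, V) ∞ (Function.uncurry fun a b ↦ f (a * b)) :=
  hf.comp (contMDiff_mul 𝓘(ℝ, E) ∞)

/-- The derivative of `f` at `g` along the left invariant field of Z is the derivative of b ↦ f(gb)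
at 1, so this is the bracket of left invariant fields acting on functions. -/
theorem dirDeriv_lie_eq [CompleteSpace E] {f : G → V} (hf : ContMDiff 𝓘(ℝ, E) 𝓘(ℝ, V) ∞ f)
    (X Y : GroupLieAlgebra 𝓘(ℝ, E) G) :
    dirDeriv f 1 ⁅X, Y⁆ = dirDeriv (fun a ↦ dirDeriv (fun b ↦ f (a * b)) 1 Y) 1 X -
      dirDeriv (fun a ↦ dirDeriv (fun b ↦ f (a * b)) 1 X) 1 Y := by
  have hfd : ∀ g, MDifferentiableAt 𝓘(ℝ, E) 𝓘(ℝ, V) f g := fun g ↦ hf.mdifferentiableAt (by simp)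
  have hv : ∀ Z : E, ∀ g, dirDeriv f g (mulInvariantVectorField (I := 𝓘(ℝ, E)) (G := G) Z g) =
      dirDeriv (fun b ↦ f (g * b)) (1 : G) Z := by
    intro Z g
    have hL : MDifferentiableAt 𝓘(ℝ, E) 𝓘(ℝ, E) (fun h : G ↦ g * h) 1 :=
      (contMDiff_mul_left (I := 𝓘(ℝ, E)) (n := ∞) (a := g)).mdifferentiableAt (by simp)
    have h1 := mfderiv_comp_apply (I' := 𝓘(ℝ, E)) (I'' := 𝓘(ℝ, V)) (1 : G)
      (hfd (g * 1)) hL Z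
    -- The base point g * 1 equals g only propositionally, so the derivative is transported along
    -- that equation.
    have e2 : ∀ (k : G) (Y : E), k = g → (mfderiv 𝓘(ℝ, E) 𝓘(ℝ, V) f k Y : V) =
      (mfderiv 𝓘(ℝ, E) 𝓘(ℝ, V) f g Y : V) := by rintro k Y rfl; rfl
    exact ((e2 _ _ (mul_one g)).symm.trans h1.symm)
  have hd : ∀ Z : E, MDifferentiableAt 𝓘(ℝ, E) 𝓘(ℝ, V)
      (fun a ↦ dirDeriv (fun b ↦ f (a * b)) (1 : G) Z) 1 := fun Z ↦
    (contMDiff_dirDeriv (contMDiff_uncurry_mul hf) 1 Z).mdifferentiableAt (by simp)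
  have hone : ∀ Z : E, mulInvariantVectorField (I := 𝓘(ℝ, E)) (G := G) Z 1 = Z :=
    mulInvariantVectorField_at_one
  have main := mfderiv_mlieBracket_eq (hf 1)
    (mdifferentiableAt_mulInvariantVectorField X) (mdifferentiableAt_mulInvariantVectorField Y)
    (Filter.Eventually.of_forall (hv X)) (Filter.Eventually.of_forall (hv Y)) (hd X) (hd Y)
  exact main.trans (congrArg₂ (· - ·)
    (congrArg (dirDeriv _ (1 : G)) (hone X))
    (congrArg (dirDeriv _ (1 : G)) (hone Y)))

end LieBracket

/-! ### The van Est map on smooth cochains: recursion, linearity, naturality. -/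

section VanEst

variable {E F G H V W : Type u}
  [NormedAddCommGroup E] [NormedSpace ℝ E] [FiniteDimensional ℝ E]
  [NormedAddCommGroup F] [NormedSpace ℝ F] [FiniteDimensional ℝ F]
  [TopologicalSpace G] [ChartedSpace E G] [Group G] [LieGroup 𝓘(ℝ, E) ∞ G]
  [TopologicalSpace H] [ChartedSpace F H] [Group H] [LieGroup 𝓘(ℝ, F) ∞ H]
  [NormedAddCommGroup V] [NormedSpace ℝ V]
  [NormedAddCommGroup W] [NormedSpace ℝ W] {n : ℕ}

variable (E) in
/-- The smooth functions of `n` variables in `G`. -/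
def smoothCochains (G V : Type u) [TopologicalSpace G] [ChartedSpace E G]
    [NormedAddCommGroup V] [NormedSpace ℝ V] (n : ℕ) : Submodule ℝ ((Fin n → G) → V) where
  carrier := {f | ContMDiff (ModelWithCorners.pi fun _ : Fin n ↦ 𝓘(ℝ, E)) 𝓘(ℝ, V) ∞ f}
  add_mem' := fun hf hf' ↦ ContMDiff.add hf hf'
  zero_mem' := contMDiff_const
  smul_mem' := fun r _ hf ↦ (contDiff_const_smul r).contMDiff.comp hf

theorem clm_comp_mem_smoothCochains (A : V →L[ℝ] W) {f : (Fin n → G) → V}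
    (hf : f ∈ smoothCochains E G V n) : (fun g ↦ A (f g)) ∈ smoothCochains E G W n :=
  A.contMDiff.comp hf

section Param

variable {D B N : Type*} [NormedAddCommGroup D] [NormedSpace ℝ D] [TopologicalSpace B]
  {J : ModelWithCorners ℝ D B} [TopologicalSpace N] [ChartedSpace B N]

theorem contMDiff_cons {a : N → G} {w : N → Fin n → G} (ha : ContMDiff J 𝓘(ℝ, E) ∞ a)
    (hw : ∀ i, ContMDiff J 𝓘(ℝ, E) ∞ (fun x ↦ w x i)) :
    ContMDiff J (ModelWithCorners.pi fun _ : Fin (n + 1) ↦ 𝓘(ℝ, E)) ∞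
      (fun x ↦ (Fin.cons (a x) (w x) : Fin (n + 1) → G)) := by
  refine contMDiff_into_pi fun i ↦ ?_
  refine Fin.cases ?_ (fun i ↦ ?_) i
  · simpa using ha
  · simpa using hw i

end Param

theorem contMDiff_cons_left {f : (Fin (n + 1) → G) → V} (hf : f ∈ smoothCochains E G V (n + 1))
    (w : Fin n → G) : ContMDiff 𝓘(ℝ, E) 𝓘(ℝ, V) ∞ (fun a : G ↦ f (Fin.cons a w)) :=
  hf.comp (contMDiff_cons contMDiff_id fun _ ↦ contMDiff_const)

theorem mdifferentiableAt_cons_left {f : (Fin (n + 1) → G) → V}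
    (hf : f ∈ smoothCochains E G V (n + 1)) (w : Fin n → G) (x : G) :
    MDifferentiableAt 𝓘(ℝ, E) 𝓘(ℝ, V) (fun a : G ↦ f (Fin.cons a w)) x :=
  (contMDiff_cons_left hf w).mdifferentiableAt (by simp)

theorem diffFirst_mem_smoothCochains (X : GroupLieAlgebra 𝓘(ℝ, E) G) {f : (Fin (n + 1) → G) → V}
    (hf : f ∈ smoothCochains E G V (n + 1)) : diffFirst X f ∈ smoothCochains E G V n :=
  contMDiff_dirDeriv (K := fun (w : Fin n → G) (a : G) ↦ f (Fin.cons a w))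
    (hf.comp (contMDiff_cons contMDiff_snd fun i ↦ (contMDiff_eval i).comp contMDiff_fst)) 1 X

/-- The derivative of `f` in its first variable, along the right invariant vector field of `X`. -/
noncomputable def diffLeft (X : GroupLieAlgebra 𝓘(ℝ, E) G) (f : (Fin (n + 1) → G) → V) :
    (Fin (n + 1) → G) → V :=
  fun g ↦ dirDeriv (fun a : G ↦ f (Fin.cons (a * g 0) (Fin.tail g))) 1 X

theorem contMDiff_mul_cons_tail {f : (Fin (n + 1) → G) → V}
    (hf : f ∈ smoothCochains E G V (n + 1)) :
    ContMDiff ((ModelWithCorners.pi fun _ : Fin (n + 1) ↦ 𝓘(ℝ, E)).prod 𝓘(ℝ, E)) 𝓘(ℝ, V) ∞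
      (Function.uncurry fun (g : Fin (n + 1) → G) (a : G) ↦
        f (Fin.cons (a * g 0) (Fin.tail g))) :=
  hf.comp (contMDiff_cons (contMDiff_snd.mul ((contMDiff_eval 0).comp contMDiff_fst))
    fun i ↦ (contMDiff_eval i.succ).comp contMDiff_fst)

/-- `diffLeft` does not preserve normalization: at g₀ = 1 it returns `diffFirst X f`. The induction
for the chain map is therefore run on all smooth cochains. -/
theorem diffLeft_mem_smoothCochains (X : GroupLieAlgebra 𝓘(ℝ, E) G) {f : (Fin (n + 1) → G) → V}
    (hf : f ∈ smoothCochains E G V (n + 1)) : diffLeft X f ∈ smoothCochains E G V (n + 1) :=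
  contMDiff_dirDeriv (contMDiff_mul_cons_tail hf) 1 X

theorem diffFirst_add (X : GroupLieAlgebra 𝓘(ℝ, E) G) {f f' : (Fin (n + 1) → G) → V}
    (hf : f ∈ smoothCochains E G V (n + 1)) (hf' : f' ∈ smoothCochains E G V (n + 1)) :
    diffFirst X (f + f') = diffFirst X f + diffFirst X f' :=
  funext fun w ↦ dirDeriv_add (mdifferentiableAt_cons_left hf w 1)
    (mdifferentiableAt_cons_left hf' w 1) X

theorem diffFirst_clm (A : V →L[ℝ] W) (X : GroupLieAlgebra 𝓘(ℝ, E) G)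
    {f : (Fin (n + 1) → G) → V} (hf : f ∈ smoothCochains E G V (n + 1)) :
    diffFirst X (fun g ↦ A (f g)) = fun g ↦ A (diffFirst X f g) :=
  funext fun w ↦ dirDeriv_clm A (mdifferentiableAt_cons_left hf w 1) X

theorem diffFirst_add_left (X Y : GroupLieAlgebra 𝓘(ℝ, E) G) (f : (Fin (n + 1) → G) → V) :
    diffFirst (X + Y) f = diffFirst X f + diffFirst Y f :=
  funext fun _ ↦ map_add (mfderiv 𝓘(ℝ, E) 𝓘(ℝ, V) _ (1 : G)) X Y

theorem diffFirst_smul_left (r : ℝ) (X : GroupLieAlgebra 𝓘(ℝ, E) G) (f : (Fin (n + 1) → G) → V) :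
    diffFirst (r • X) f = r • diffFirst X f :=
  funext fun _ ↦ map_smul (mfderiv 𝓘(ℝ, E) 𝓘(ℝ, V) _ (1 : G)) r X

/-- With the other variables fixed at w, both terms are mixed derivatives of f(ab, w) at a = b = 1.
Exchanging the order of differentiation turns the difference into the formula of `dirDeriv_lie_eq`.
-/
theorem diffFirst_diffLeft_sub (X Y : GroupLieAlgebra 𝓘(ℝ, E) G) {f : (Fin (n + 1) → G) → V}
    (hf : f ∈ smoothCochains E G V (n + 1)) :
    diffFirst Y (diffLeft X f) - diffFirst X (diffLeft Y f) = diffFirst ⁅X, Y⁆ f := by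
  funext w
  have hF := contMDiff_cons_left hf w
  have h := fun X Y : GroupLieAlgebra 𝓘(ℝ, E) G ↦
    dirDeriv_dirDeriv_comm (contMDiff_uncurry_mul hF) 1 1 X Y
  refine (congrArg₂ (· - ·) (h X Y) (h Y X)).trans ?_
  exact (dirDeriv_lie_eq hF X Y).symm

theorem vanEst_zero (f : (Fin 0 → G) → V) :
    vanEst (E := E) 0 f = fun _ ↦ f Fin.elim0 := by
  funext X
  simp [vanEst, diffAll]

theorem vanEst_succ (f : (Fin (n + 1) → G) → V) :
    vanEst (E := E) (n + 1) f = uncurrySum (fun X ↦ vanEst n (diffFirst X f)) := by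
  funext X
  refine (sum_perm_succ (fun Y : Fin (n + 1) → GroupLieAlgebra 𝓘(ℝ, E) G ↦
    diffAll n (diffFirst (Y 0) f) (Fin.tail Y)) X).trans ?_
  simp only [Fin.cons_zero, Fin.tail_cons]
  rfl

theorem vanEst_add {f f' : (Fin n → G) → V} (hf : f ∈ smoothCochains E G V n)
    (hf' : f' ∈ smoothCochains E G V n) :
    vanEst (E := E) n (f + f') = vanEst n f + vanEst n f' := by
  induction n with
  | zero => simp only [vanEst_zero]; rfl
  | succ n ih =>
    rw [vanEst_succ, vanEst_succ, vanEst_succ, ← uncurrySum_add]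
    refine congrArg uncurrySum (funext fun X ↦ ?_)
    rw [diffFirst_add X hf hf', ih (diffFirst_mem_smoothCochains X hf)
      (diffFirst_mem_smoothCochains X hf')]
    rfl

/-- Used with `A` equal to ψ, to ρ(X) and to a scalar. -/
theorem vanEst_clm (A : V →L[ℝ] W) {f : (Fin n → G) → V} (hf : f ∈ smoothCochains E G V n) :
    vanEst (E := E) n (fun g ↦ A (f g)) = fun X ↦ A (vanEst n f X) := by
  induction n with
  | zero => simp only [vanEst_zero]
  | succ n ih =>
    rw [vanEst_succ, vanEst_succ]
    funext x
    refine Eq.trans ?_ (map_uncurrySum (A : V →ₗ[ℝ] W) _ x).symm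
    refine congrArg (uncurrySum · x) (funext fun X ↦ ?_)
    rw [diffFirst_clm A X hf, ih (diffFirst_mem_smoothCochains X hf)]
    rfl

theorem vanEst_smul (r : ℝ) {f : (Fin n → G) → V} (hf : f ∈ smoothCochains E G V n) :
    vanEst (E := E) n (r • f) = r • vanEst n f :=
  vanEst_clm (r • ContinuousLinearMap.id ℝ V) hf

theorem vanEst_sub {f f' : (Fin n → G) → V} (hf : f ∈ smoothCochains E G V n)
    (hf' : f' ∈ smoothCochains E G V n) :
    vanEst (E := E) n (f - f') = vanEst n f - vanEst n f' := by
  have h := vanEst_add (Submodule.sub_mem _ hf hf') hf'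
  rw [sub_add_cancel] at h
  rw [h, add_sub_cancel_right]

/-- By the recursion it suffices that the van Est image of `diffFirst X f` is alternating, by
induction, and linear in X. -/
theorem vanEst_mem_ceCochains {f : (Fin n → G) → V} (hf : f ∈ smoothCochains E G V n) :
    vanEst n f ∈ ceCochains (GroupLieAlgebra 𝓘(ℝ, E) G) V n := by
  induction n with
  | zero =>
    rw [vanEst_zero]
    exact ⟨AlternatingMap.constOfIsEmpty ℝ _ (Fin 0) (f Fin.elim0), rfl⟩
  | succ n ih =>
    rw [vanEst_succ]
    refine uncurrySum_mem_ceCochains _ (fun X ↦ ih (diffFirst_mem_smoothCochains X hf))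
      (fun X Y ↦ ?_) (fun r X ↦ ?_)
    · rw [diffFirst_add_left, vanEst_add (diffFirst_mem_smoothCochains X hf)
        (diffFirst_mem_smoothCochains Y hf)]
    · rw [diffFirst_smul_left, vanEst_smul r (diffFirst_mem_smoothCochains X hf)]

theorem comp_mem_smoothCochains (Φ : ContMDiffMonoidMorphism 𝓘(ℝ, E) 𝓘(ℝ, F) ∞ G H)
    {f : (Fin n → H) → W} (hf : f ∈ smoothCochains F H W n) :
    (fun g ↦ f (Φ ∘ g)) ∈ smoothCochains E G W n :=
  hf.comp (contMDiff_into_pi fun i ↦ Φ.contMDiff_toFun.comp (contMDiff_eval i))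

theorem dirDeriv_comp_hom (Φ : ContMDiffMonoidMorphism 𝓘(ℝ, E) 𝓘(ℝ, F) ∞ G H) {f : H → W}
    (hf : ContMDiff 𝓘(ℝ, F) 𝓘(ℝ, W) ∞ f) (X : GroupLieAlgebra 𝓘(ℝ, E) G) :
    dirDeriv (fun a ↦ f (Φ a)) 1 X = dirDeriv f 1 (lieHom Φ X) := by
  have h := mfderiv_comp_apply (1 : G)
    (hf.mdifferentiableAt (by simp) : MDifferentiableAt 𝓘(ℝ, F) 𝓘(ℝ, W) f (Φ 1))
    (Φ.contMDiff_toFun.mdifferentiableAt (by simp) : MDifferentiableAt 𝓘(ℝ, E) 𝓘(ℝ, F) Φ 1) X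
  have e1 : ∀ (k : H) (Y : F), k = 1 →
      (mfderiv 𝓘(ℝ, F) 𝓘(ℝ, W) f k Y : W) = dirDeriv f (1 : H) Y := by rintro k Y rfl; rfl
  exact h.trans (e1 _ _ (map_one Φ))

theorem diffFirst_comp (Φ : ContMDiffMonoidMorphism 𝓘(ℝ, E) 𝓘(ℝ, F) ∞ G H)
    {f : (Fin (n + 1) → H) → W} (hf : f ∈ smoothCochains F H W (n + 1))
    (X : GroupLieAlgebra 𝓘(ℝ, E) G) :
    diffFirst X (fun g ↦ f (Φ ∘ g)) = fun g ↦ diffFirst (lieHom Φ X) f (Φ ∘ g) := by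
  funext w
  refine Eq.trans ?_ (dirDeriv_comp_hom Φ (contMDiff_cons_left hf (Φ ∘ w)) X)
  refine congrArg (fun k ↦ dirDeriv k (1 : G) X) (funext fun a ↦ congrArg f (funext fun i ↦ ?_))
  refine Fin.cases ?_ (fun i ↦ ?_) i <;> simp

theorem vanEst_comp (Φ : ContMDiffMonoidMorphism 𝓘(ℝ, E) 𝓘(ℝ, F) ∞ G H)
    {f : (Fin n → H) → W} (hf : f ∈ smoothCochains F H W n) :
    vanEst (E := E) n (fun g ↦ f (Φ ∘ g)) = fun X ↦ vanEst n f (lieHom Φ ∘ X) := by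
  induction n with
  | zero =>
    simp only [vanEst_zero]
    funext X
    exact congrArg f (Subsingleton.elim _ _)
  | succ n ih =>
    rw [vanEst_succ, vanEst_succ]
    funext x
    refine Finset.sum_congr rfl fun i _ ↦ ?_
    beta_reduce
    rw [diffFirst_comp Φ hf, ih (diffFirst_mem_smoothCochains _ hf)]
    rfl

end VanEst

/-! ### Compatibility of the van Est map with the differentials. -/

section ChainMap

variable {E F G H V W : Type u}
  [NormedAddCommGroup E] [NormedSpace ℝ E] [FiniteDimensional ℝ E]
  [NormedAddCommGroup F] [NormedSpace ℝ F] [FiniteDimensional ℝ F]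
  [TopologicalSpace G] [ChartedSpace E G] [Group G] [LieGroup 𝓘(ℝ, E) ∞ G]
  [TopologicalSpace H] [ChartedSpace F H] [Group H] [LieGroup 𝓘(ℝ, F) ∞ H]
  [NormedAddCommGroup V] [NormedSpace ℝ V] [FiniteDimensional ℝ V]
  [NormedAddCommGroup W] [NormedSpace ℝ W] [FiniteDimensional ℝ W] {n : ℕ}

theorem groupRep_apply (ϱ : ContMDiffMonoidMorphism 𝓘(ℝ, E) 𝓘(ℝ, V →L[ℝ] V) ∞ G (V →L[ℝ] V)ˣ)
    (g : G) (v : V) : groupRep ϱ g v = (ϱ g : V →L[ℝ] V) v := rfl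

theorem mdifferentiableAt_rep
    (ϱ : ContMDiffMonoidMorphism 𝓘(ℝ, E) 𝓘(ℝ, V →L[ℝ] V) ∞ G (V →L[ℝ] V)ˣ) (v : V) (x : G) :
    MDifferentiableAt 𝓘(ℝ, E) 𝓘(ℝ, V) (fun a ↦ groupRep ϱ a v) x :=
  ContMDiff.mdifferentiableAt (n := ∞)
    ((ContinuousLinearMap.apply ℝ V v).contMDiff.comp (contMDiff_val_rep ϱ)) (by simp)

theorem dirDeriv_rep (ϱ : ContMDiffMonoidMorphism 𝓘(ℝ, E) 𝓘(ℝ, V →L[ℝ] V) ∞ G (V →L[ℝ] V)ˣ)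
    (v : V) (X : GroupLieAlgebra 𝓘(ℝ, E) G) :
    dirDeriv (fun a ↦ groupRep ϱ a v) 1 X = lieRep ϱ X v :=
  dirDeriv_clm (ContinuousLinearMap.apply ℝ V v)
    ((contMDiff_val_rep ϱ).mdifferentiableAt (by simp)) X

theorem rep_comp_mem_smoothCochains
    (ϱ : ContMDiffMonoidMorphism 𝓘(ℝ, E) 𝓘(ℝ, V →L[ℝ] V) ∞ G (V →L[ℝ] V)ˣ)
    {f : (Fin n → G) → V} (hf : f ∈ smoothCochains E G V n) :
    (fun g : Fin (n + 1) → G ↦ groupRep ϱ (g 0) (f (Fin.tail g))) ∈ smoothCochains E G V (n + 1) :=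
  ContMDiff.clm_apply ((contMDiff_val_rep ϱ).comp (contMDiff_eval 0))
    (hf.comp (contMDiff_into_pi fun i ↦ contMDiff_eval i.succ))

theorem groupDifferential_mem_smoothCochains
    (ϱ : ContMDiffMonoidMorphism 𝓘(ℝ, E) 𝓘(ℝ, V →L[ℝ] V) ∞ G (V →L[ℝ] V)ˣ)
    {f : (Fin n → G) → V} (hf : f ∈ smoothCochains E G V n) :
    groupDifferential (groupRep ϱ) n f ∈ smoothCochains E G V (n + 1) := by
  have e : groupDifferential (groupRep ϱ) n f =
      (fun g : Fin (n + 1) → G ↦ groupRep ϱ (g 0) (f (Fin.tail g))) +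
      ∑ i : Fin n, (-1 : ℝ) ^ ((i : ℕ) + 1) •
        (fun g : Fin (n + 1) → G ↦ f (Fin.contractNth i.castSucc (· * ·) g)) +
      (-1 : ℝ) ^ (n + 1) • (fun g : Fin (n + 1) → G ↦ f (Fin.init g)) := by
    funext g
    simp [groupDifferential_apply]
  rw [e]
  refine Submodule.add_mem _ (Submodule.add_mem _ (rep_comp_mem_smoothCochains ϱ hf)
    (Submodule.sum_mem _ fun i _ ↦ Submodule.smul_mem _ _ ?_)) (Submodule.smul_mem _ _ ?_)
  · refine ContMDiff.comp hf (contMDiff_into_pi fun k ↦ ?_)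
    simp only [Fin.contractNth]
    split_ifs
    · exact contMDiff_eval _
    · exact (contMDiff_eval _).mul (contMDiff_eval _)
    · exact contMDiff_eval _
  · exact ContMDiff.comp hf (contMDiff_into_pi fun k ↦ contMDiff_eval k.castSucc)

theorem mdifferentiableAt_fun_add {f g : G → V} {x : G}
    (hf : MDifferentiableAt 𝓘(ℝ, E) 𝓘(ℝ, V) f x) (hg : MDifferentiableAt 𝓘(ℝ, E) 𝓘(ℝ, V) g x) :
    MDifferentiableAt 𝓘(ℝ, E) 𝓘(ℝ, V) (fun a ↦ f a + g a) x :=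
  hf.add hg

theorem mdifferentiableAt_fun_sub {f g : G → V} {x : G}
    (hf : MDifferentiableAt 𝓘(ℝ, E) 𝓘(ℝ, V) f x) (hg : MDifferentiableAt 𝓘(ℝ, E) 𝓘(ℝ, V) g x) :
    MDifferentiableAt 𝓘(ℝ, E) 𝓘(ℝ, V) (fun a ↦ f a - g a) x :=
  hf.sub hg

theorem dirDeriv_sub {f g : G → V} {x : G} (hf : MDifferentiableAt 𝓘(ℝ, E) 𝓘(ℝ, V) f x)
    (hg : MDifferentiableAt 𝓘(ℝ, E) 𝓘(ℝ, V) g x) (X : TangentSpace 𝓘(ℝ, E) x) :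
    dirDeriv (fun a ↦ f a - g a) x X = dirDeriv f x X - dirDeriv g x X :=
  congrArg (fun T : E →L[ℝ] V ↦ T X) (hf.hasMFDerivAt.sub hg.hasMFDerivAt).mfderiv

theorem dirDeriv_sum {ι : Type*} (s : Finset ι) {f : ι → G → V} {x : G}
    (hf : ∀ i, MDifferentiableAt 𝓘(ℝ, E) 𝓘(ℝ, V) (f i) x) (X : TangentSpace 𝓘(ℝ, E) x) :
    MDifferentiableAt 𝓘(ℝ, E) 𝓘(ℝ, V) (fun a ↦ ∑ i ∈ s, f i a) x ∧
      dirDeriv (fun a ↦ ∑ i ∈ s, f i a) x X = ∑ i ∈ s, dirDeriv (f i) x X := by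
  classical
  induction s using Finset.induction_on with
  | empty => simpa using ⟨mdifferentiableAt_const, dirDeriv_const (0 : V) x X⟩
  | insert i s hi ih =>
    simp only [Finset.sum_insert hi]
    exact ⟨(hf i).add ih.1, (dirDeriv_add (hf i) ih.1 X).trans (by rw [ih.2])⟩

/-- The coboundary in the remaining variables is, at fixed `g`, a finite sum of fixed linear maps
applied to values of `f (a, ·)`, so it commutes with differentiation in `a`. -/
theorem dirDeriv_groupDifferential_cons
    (ρ : G → V →L[ℝ] V) (σ : Representation ℝ G V) (hσ : ∀ g v, σ g v = ρ g v)
    {f : (Fin (n + 1) → G) → V} (hf : f ∈ smoothCochains E G V (n + 1))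
    (X : GroupLieAlgebra 𝓘(ℝ, E) G) (g : Fin (n + 1) → G) :
    MDifferentiableAt 𝓘(ℝ, E) 𝓘(ℝ, V)
      (fun a : G ↦ groupDifferential σ n (fun h ↦ f (Fin.cons a h)) g) 1 ∧
    dirDeriv (fun a : G ↦ groupDifferential σ n (fun h ↦ f (Fin.cons a h)) g) 1 X =
      groupDifferential σ n (diffFirst X f) g := by
  simp only [groupDifferential_apply, hσ]
  have hA : ∀ (A : V →L[ℝ] V) w, MDifferentiableAt 𝓘(ℝ, E) 𝓘(ℝ, V)
      (fun a : G ↦ A (f (Fin.cons a w))) 1 := fun A w ↦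
    ContMDiff.mdifferentiableAt (n := ∞) (A.contMDiff.comp (contMDiff_cons_left hf w)) (by simp)
  have hA' : ∀ (A : V →L[ℝ] V) w, dirDeriv (fun a : G ↦ A (f (Fin.cons a w))) 1 X =
      A (diffFirst X f w) := fun A w ↦
    dirDeriv_clm A (mdifferentiableAt_cons_left hf w 1) X
  have hr : ∀ (r : ℝ) w, MDifferentiableAt 𝓘(ℝ, E) 𝓘(ℝ, V)
      (fun a : G ↦ r • (f (Fin.cons a w))) 1 := fun r w ↦
    hA (r • ContinuousLinearMap.id ℝ V) w
  have hr' : ∀ (r : ℝ) w, dirDeriv (fun a : G ↦ r • (f (Fin.cons a w))) 1 X =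
      r • diffFirst X f w := fun r w ↦ hA' (r • ContinuousLinearMap.id ℝ V) w
  have hs := dirDeriv_sum Finset.univ (fun i : Fin n ↦ hr ((-1 : ℝ) ^ ((i : ℕ) + 1))
    (Fin.contractNth i.castSucc (· * ·) g)) X
  have hm := mdifferentiableAt_fun_add (hA (ρ (g 0)) (Fin.tail g)) hs.1
  refine ⟨hm.add (hr _ _), ?_⟩
  rw [dirDeriv_add hm (hr _ _), dirDeriv_add (hA _ _) hs.1, hs.2, hA', hr']
  simp only [hr']

theorem diffFirst_groupDifferential
    (ϱ : ContMDiffMonoidMorphism 𝓘(ℝ, E) 𝓘(ℝ, V →L[ℝ] V) ∞ G (V →L[ℝ] V)ˣ)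
    {f : (Fin (n + 1) → G) → V} (hf : f ∈ smoothCochains E G V (n + 1))
    (X : GroupLieAlgebra 𝓘(ℝ, E) G) :
    diffFirst X (groupDifferential (groupRep ϱ) (n + 1) f) =
      (fun g ↦ lieRep ϱ X (f g)) - diffLeft X f +
        (fun g ↦ groupRep ϱ (g 0) (diffFirst X f (Fin.tail g))) -
        groupDifferential (groupRep ϱ) n (diffFirst X f) := by
  funext g
  have h4 := dirDeriv_groupDifferential_cons (fun g ↦ (ϱ g : V →L[ℝ] V)) (groupRep ϱ)
    (groupRep_apply ϱ) hf X g
  have h2 := mdifferentiableAt_right (contMDiff_mul_cons_tail hf) g 1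
  have h1 := mdifferentiableAt_rep ϱ (f g) 1
  have h3 : MDifferentiableAt 𝓘(ℝ, E) 𝓘(ℝ, V)
      (fun a : G ↦ groupRep ϱ (g 0) (f (Fin.cons a (Fin.tail g)))) 1 :=
    ContMDiff.mdifferentiableAt (n := ∞)
      ((ϱ (g 0) : V →L[ℝ] V).contMDiff.comp (contMDiff_cons_left hf (Fin.tail g))) (by simp)
  have e3 : dirDeriv (fun a : G ↦ groupRep ϱ (g 0) (f (Fin.cons a (Fin.tail g)))) 1 X =
      groupRep ϱ (g 0) (diffFirst X f (Fin.tail g)) :=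
    dirDeriv_clm (ϱ (g 0) : V →L[ℝ] V) (mdifferentiableAt_cons_left hf _ 1) X
  simp only [diffFirst, groupDifferential_cons]
  have h5 := mdifferentiableAt_fun_sub h1 h2
  rw [dirDeriv_sub (mdifferentiableAt_fun_add h5 h3) h4.1, dirDeriv_add h5 h3, dirDeriv_sub h1 h2,
    dirDeriv_rep, e3, h4.2]
  rfl

theorem diffFirst_rep_comp
    (ϱ : ContMDiffMonoidMorphism 𝓘(ℝ, E) 𝓘(ℝ, V →L[ℝ] V) ∞ G (V →L[ℝ] V)ˣ)
    (f : (Fin n → G) → V) (X : GroupLieAlgebra 𝓘(ℝ, E) G) :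
    diffFirst X (fun g : Fin (n + 1) → G ↦ groupRep ϱ (g 0) (f (Fin.tail g))) =
      fun g ↦ lieRep ϱ X (f g) := by
  funext g
  exact dirDeriv_rep ϱ (f g) X

theorem vanEst_lieRep
    (ϱ : ContMDiffMonoidMorphism 𝓘(ℝ, E) 𝓘(ℝ, V →L[ℝ] V) ∞ G (V →L[ℝ] V)ˣ)
    {f : (Fin n → G) → V} (hf : f ∈ smoothCochains E G V n) (X : GroupLieAlgebra 𝓘(ℝ, E) G) :
    vanEst (E := E) n (fun g ↦ lieRep ϱ X (f g)) = fun Y ↦ lieRep ϱ X (vanEst n f Y) :=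
  vanEst_clm (LinearMap.toContinuousLinearMap (lieRep ϱ X)) hf

theorem ceBracketSum_uncurrySum {L : Type u} [LieRing L] [LieAlgebra ℝ L]
    (η : L → (Fin n → L) → V) :
    ceBracketSum (n + 1) (uncurrySum η) =
      bracketSum η - uncurrySum (fun a ↦ ceBracketSum n (η a)) := by
  rw [ceBracketSum_succ]
  cases n with
  | zero =>
    simp only [uncurrySum_cons_zero]
    funext x
    simp [ceBracketSum, uncurrySum]
  | succ n => exact bracketSum_cons_uncurrySum η

theorem vanEst_groupDifferential
    (ϱ : ContMDiffMonoidMorphism 𝓘(ℝ, E) 𝓘(ℝ, V →L[ℝ] V) ∞ G (V →L[ℝ] V)ˣ)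
    {f : (Fin n → G) → V} (hf : f ∈ smoothCochains E G V n) :
    vanEst (n + 1) (groupDifferential (groupRep ϱ) n f) =
      ceDifferential (lieRep ϱ) n (vanEst n f) := by
  induction n with
  | zero =>
    rw [ceDifferential_apply, vanEst_succ]
    refine Eq.trans ?_ (add_zero _).symm
    refine congrArg uncurrySum (funext fun X ↦ ?_)
    rw [vanEst_zero, vanEst_zero]
    funext w
    have e : ∀ a : G, groupDifferential (groupRep ϱ) 0 f (Fin.cons a Fin.elim0) =
        groupRep ϱ a (f Fin.elim0) + -f Fin.elim0 := fun a ↦ by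
      rw [groupDifferential_apply, Subsingleton.elim (Fin.init _) Fin.elim0,
        Subsingleton.elim (Fin.tail _) Fin.elim0]
      simp
    simp only [diffFirst, e]
    rw [dirDeriv_add (mdifferentiableAt_rep ϱ _ 1) mdifferentiableAt_const, dirDeriv_rep,
      dirDeriv_const, add_zero]
  | succ n ih =>
    have hD := fun X : GroupLieAlgebra 𝓘(ℝ, E) G ↦ diffFirst_mem_smoothCochains (E := E) X hf
    -- After the induction hypothesis, the representation part of δ vE(D_X f) has cancelled against
    -- the term g₀ D_X f(tail g).
    have key : ∀ X : GroupLieAlgebra 𝓘(ℝ, E) G,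
        vanEst (n + 1) (diffFirst X (groupDifferential (groupRep ϱ) (n + 1) f)) =
        (fun w ↦ lieRep ϱ X (vanEst (n + 1) f w)) -
          uncurrySum (fun Y : GroupLieAlgebra 𝓘(ℝ, E) G ↦ vanEst n (diffFirst Y (diffLeft X f))) -
          ceBracketSum n (vanEst n (diffFirst X f)) := by
      intro X
      have m1 : (fun g ↦ lieRep ϱ X (f g)) ∈ smoothCochains E G V (n + 1) :=
        clm_comp_mem_smoothCochains (LinearMap.toContinuousLinearMap (lieRep ϱ X)) hf
      have m2 := diffLeft_mem_smoothCochains X hf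
      have m3 := rep_comp_mem_smoothCochains ϱ (hD X)
      have m4 := groupDifferential_mem_smoothCochains ϱ (hD X)
      rw [diffFirst_groupDifferential ϱ hf,
        vanEst_sub (Submodule.add_mem _ (Submodule.sub_mem _ m1 m2) m3) m4,
        vanEst_add (Submodule.sub_mem _ m1 m2) m3, vanEst_sub m1 m2, vanEst_lieRep ϱ hf, ih (hD X),
        ceDifferential_apply, vanEst_succ (diffLeft X f),
        vanEst_succ (fun g : Fin (n + 1) → G ↦ groupRep ϱ (g 0) (diffFirst X f (Fin.tail g)))]
      simp only [diffFirst_rep_comp, vanEst_lieRep ϱ (hD X)]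
      abel
    rw [vanEst_succ, ceDifferential_apply, vanEst_succ f, ceBracketSum_uncurrySum]
    simp only [key]
    -- Only here does the bracket of the Lie algebra arise from the multiplication of `G`.
    have hQ := uncurrySum_uncurrySum
      (fun X Y : GroupLieAlgebra 𝓘(ℝ, E) G ↦ vanEst n (diffFirst Y (diffLeft X f)))
      (fun X : GroupLieAlgebra 𝓘(ℝ, E) G ↦ vanEst n (diffFirst X f)) (fun X Y w ↦ by
        rw [← diffFirst_diffLeft_sub X Y hf, vanEst_sub]
        · rfl
        · exact diffFirst_mem_smoothCochains _ (diffLeft_mem_smoothCochains _ hf)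
        · exact diffFirst_mem_smoothCochains _ (diffLeft_mem_smoothCochains _ hf))
    rw [← vanEst_succ f]
    refine (uncurrySum_sub _ _).trans ?_
    rw [show uncurrySum (fun X : GroupLieAlgebra 𝓘(ℝ, E) G ↦
          (fun w ↦ lieRep ϱ X (vanEst (n + 1) f w)) -
          uncurrySum (fun Y : GroupLieAlgebra 𝓘(ℝ, E) G ↦ vanEst n (diffFirst Y (diffLeft X f)))) =
        _ from uncurrySum_sub _ _, hQ]
    abel

end ChainMap

/-! ### The complex of a morphism, abstractly. -/

section MorphismComplex

variable {S T V W : Type u} [AddCommGroup V] [Module ℝ V] [AddCommGroup W] [Module ℝ W]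

theorem isCochainComplex_morphism {A : ∀ n, Submodule ℝ ((Fin n → S) → V)}
    {B : ∀ n, Submodule ℝ ((Fin n → T) → W)} {C : ∀ n, Submodule ℝ ((Fin n → S) → W)}
    {d₁ : ∀ n, ((Fin n → S) → V) →ₗ[ℝ] ((Fin (n + 1) → S) → V)}
    {d₂ : ∀ n, ((Fin n → T) → W) →ₗ[ℝ] ((Fin (n + 1) → T) → W)}
    {d₃ : ∀ n, ((Fin n → S) → W) →ₗ[ℝ] ((Fin (n + 1) → S) → W)}
    {φ : S → T} {ψ : V →ₗ[ℝ] W}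
    (hA : IsCochainComplex A d₁) (hB : IsCochainComplex B d₂) (hC : IsCochainComplex C d₃)
    (hA0 : ∀ v, (fun _ ↦ v) ∈ A 0) (hB0 : ∀ w, (fun _ ↦ w) ∈ B 0)
    (hψ : ∀ n, ∀ f ∈ A n, (fun x ↦ ψ (f x)) ∈ C n)
    (hφ : ∀ n, ∀ f ∈ B n, (fun x ↦ f (φ ∘ x)) ∈ C n)
    (dψ : ∀ n, ∀ f ∈ A n, d₃ n (fun x ↦ ψ (f x)) = fun x ↦ ψ (d₁ n f x))
    (dφ : ∀ n, ∀ f ∈ B n, d₃ n (fun x ↦ f (φ ∘ x)) = fun x ↦ d₂ n f (φ ∘ x)) :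
    IsCochainComplex (morphismCochains A B C) (morphismDifferential d₁ d₂ d₃ φ ψ) where
  map_mem n c hc := by
    cases n with
    | zero => exact ⟨hA.map_mem 0 _ (hA0 c), hB.map_mem 0 _ (hB0 (ψ c)), (C 0).zero_mem⟩
    | succ n =>
      obtain ⟨a, b, e⟩ := c
      obtain ⟨ha, hb, he⟩ := hc
      exact ⟨hA.map_mem _ _ ha, hB.map_mem _ _ hb,
        (C _).sub_mem ((C _).sub_mem (hψ _ _ ha) (hφ _ _ hb)) (hC.map_mem _ _ he)⟩
  d_comp_d n c hc := by
    cases n with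
    | zero =>
      refine Prod.ext (hA.d_comp_d 0 _ (hA0 c)) (Prod.ext (hB.d_comp_d 0 _ (hB0 (ψ c))) ?_)
      funext x
      -- Both nonzero terms equal d₃ of the constant ψ(c), by naturality under ψ and under φ.
      change ψ (d₁ 0 (fun _ ↦ c) x) - d₂ 0 (fun _ ↦ ψ c) (φ ∘ x) - d₃ 0 0 x = 0
      have h1 := congrFun (dψ 0 _ (hA0 c)) x
      have h2 := congrFun (dφ 0 _ (hB0 (ψ c))) x
      rw [map_zero, Pi.zero_apply, sub_zero, ← h2]
      exact sub_eq_zero.2 h1.symm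
    | succ n =>
      obtain ⟨a, b, e⟩ := c
      obtain ⟨ha, hb, he⟩ := hc
      refine Prod.ext (hA.d_comp_d _ _ ha) (Prod.ext (hB.d_comp_d _ _ hb) ?_)
      funext x
      change ψ (d₁ (n + 1) a x) - d₂ (n + 1) b (φ ∘ x) -
        d₃ (n + 1) ((fun x ↦ ψ (a x)) - (fun x ↦ b (φ ∘ x)) - d₃ n e) x = 0
      rw [map_sub, map_sub, hC.d_comp_d _ _ he, dψ _ _ ha, dφ _ _ hb]
      simp

end MorphismComplex

/-! ### The induced map on cohomology. -/

section CohomologyMap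

variable {A A' : ℕ → Type u} [∀ n, AddCommGroup (A n)] [∀ n, Module ℝ (A n)]
  [∀ n, AddCommGroup (A' n)] [∀ n, Module ℝ (A' n)]
  {C : ∀ n, Submodule ℝ (A n)} {d : ∀ n, A n →ₗ[ℝ] A (n + 1)}
  {C' : ∀ n, Submodule ℝ (A' n)} {d' : ∀ n, A' n →ₗ[ℝ] A' (n + 1)} {F : ∀ n, A n → A' n}

theorem IsCochainMap.map_zero (hF : IsCochainMap C d C' d' F) (n : ℕ) : F n 0 = 0 := by
  simpa using hF.map_smul n 0 0 (C n).zero_mem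

/-- The map induced on cocycles by a homomorphism of cochain complexes. -/
def IsCochainMap.cocyclesMap (hF : IsCochainMap C d C' d' F) (n : ℕ) :
    cocycles C d n →ₗ[ℝ] cocycles C' d' n where
  toFun z := ⟨F n z.1, hF.map_mem n _ z.2.1, by
    rw [SetLike.mem_coe, LinearMap.mem_ker, ← hF.comm n _ z.2.1, LinearMap.mem_ker.1 z.2.2,
      hF.map_zero]⟩
  map_add' z w := Subtype.ext (hF.map_add n _ z.2.1 _ w.2.1)
  map_smul' r z := Subtype.ext (hF.map_smul n r _ z.2.1)

theorem IsCochainMap.exists_cohomologyMap (hF : IsCochainMap C d C' d' F) :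
    ∃ φ : ∀ n, Cohomology C d n →ₗ[ℝ] Cohomology C' d' n,
      ∀ n (z : cocycles C d n), ∃ w : cocycles C' d' n,
        w.1 = F n z.1 ∧ φ n (cohomologyClass _ _ n z) = cohomologyClass _ _ n w := by
  refine ⟨fun n ↦ Submodule.mapQ _ _ (hF.cocyclesMap n) ?_, fun n z ↦
    ⟨hF.cocyclesMap n z, rfl, rfl⟩⟩
  intro z hz
  change F n z.1 ∈ coboundaries C' d' n
  have hz' : z.1 ∈ coboundaries C d n := hz
  cases n with
  | zero =>
    rw [(Submodule.mem_bot ℝ).1 hz', hF.map_zero]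
    exact Submodule.zero_mem _
  | succ n =>
    obtain ⟨c, hc, hcz⟩ := hz'
    exact ⟨F n c, hF.map_mem n c hc, by rw [← hcz, hF.comm n c hc]⟩

end CohomologyMap

/-! ### Assembly for morphisms of Lie groups and Lie algebras. -/

section MorphismLieGroup

variable {E F G H V W : Type u}
  [NormedAddCommGroup E] [NormedSpace ℝ E] [FiniteDimensional ℝ E]
  [NormedAddCommGroup F] [NormedSpace ℝ F] [FiniteDimensional ℝ F]
  [TopologicalSpace G] [ChartedSpace E G] [Group G] [LieGroup 𝓘(ℝ, E) ∞ G]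
  [TopologicalSpace H] [ChartedSpace F H] [Group H] [LieGroup 𝓘(ℝ, F) ∞ H]
  [NormedAddCommGroup V] [NormedSpace ℝ V] [FiniteDimensional ℝ V]
  [NormedAddCommGroup W] [NormedSpace ℝ W] [FiniteDimensional ℝ W] 

/-- The Lie group representation of `G` obtained from one of `H` by a homomorphism `G → H`. -/
def pullbackRep (Φ : ContMDiffMonoidMorphism 𝓘(ℝ, E) 𝓘(ℝ, F) ∞ G H)
    (ϱ : ContMDiffMonoidMorphism 𝓘(ℝ, F) 𝓘(ℝ, W →L[ℝ] W) ∞ H (W →L[ℝ] W)ˣ) :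
    ContMDiffMonoidMorphism 𝓘(ℝ, E) 𝓘(ℝ, W →L[ℝ] W) ∞ G (W →L[ℝ] W)ˣ where
  toMonoidHom := ϱ.toMonoidHom.comp Φ.toMonoidHom
  contMDiff_toFun := ϱ.contMDiff_toFun.comp Φ.contMDiff_toFun

/-- The chain rule at 1. It matches the coefficients of the third summand on the two sides. -/
theorem lieRep_pullbackRep (Φ : ContMDiffMonoidMorphism 𝓘(ℝ, E) 𝓘(ℝ, F) ∞ G H)
    (ϱ : ContMDiffMonoidMorphism 𝓘(ℝ, F) 𝓘(ℝ, W →L[ℝ] W) ∞ H (W →L[ℝ] W)ˣ) :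
    lieRep (pullbackRep Φ ϱ) = (lieRep ϱ).comp (lieHom Φ) := by
  refine LieHom.ext fun X ↦ LinearMap.ext fun v ↦ ?_
  exact congrArg (fun A : W →L[ℝ] W ↦ A v) (dirDeriv_comp_hom Φ (contMDiff_val_rep ϱ) X)

theorem isCochainComplex_differentiableCochains
    (ϱ : ContMDiffMonoidMorphism 𝓘(ℝ, E) 𝓘(ℝ, V →L[ℝ] V) ∞ G (V →L[ℝ] V)ˣ) :
    IsCochainComplex (differentiableCochains E G V) (groupDifferential (groupRep ϱ)) where
  map_mem _ _ hf := ⟨groupDifferential_mem_smoothCochains ϱ hf.1,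
    groupDifferential_eq_zero (groupRep ϱ) hf.2⟩
  d_comp_d _ f _ := groupDifferential_groupDifferential (groupRep ϱ) f

theorem isCochainComplex_ceCochains {L V : Type u} [LieRing L] [LieAlgebra ℝ L] [AddCommGroup V]
    [Module ℝ V] (ρ : L →ₗ⁅ℝ⁆ Module.End ℝ V) :
    IsCochainComplex (ceCochains L V) (ceDifferential ρ) where
  map_mem _ _ hf := ceDifferential_mem_ceCochains ρ hf
  d_comp_d _ _ hf := ceDifferential_ceDifferential ρ hf

theorem const_mem_ceCochains {L V : Type u} [LieRing L] [LieAlgebra ℝ L] [AddCommGroup V]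
    [Module ℝ V] (v : V) : (fun _ ↦ v) ∈ ceCochains L V 0 :=
  ⟨AlternatingMap.constOfIsEmpty ℝ _ (Fin 0) v, rfl⟩

theorem ceDifferential_map {L V W : Type u} [LieRing L] [LieAlgebra ℝ L] [AddCommGroup V]
    [Module ℝ V] [AddCommGroup W] [Module ℝ W] {n : ℕ} (ρ : L →ₗ⁅ℝ⁆ Module.End ℝ V)
    (σ : L →ₗ⁅ℝ⁆ Module.End ℝ W) (A : V →ₗ[ℝ] W) (hA : ∀ x v, A (ρ x v) = σ x (A v))
    (f : (Fin n → L) → V) :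
    ceDifferential σ n (fun x ↦ A (f x)) = fun x ↦ A (ceDifferential ρ n f x) := by
  funext x
  simp only [ceDifferential_apply, Pi.add_apply, map_add, map_uncurrySum, hA]
  cases n with
  | zero => exact congrArg (_ + ·) (map_zero A).symm
  | succ n => simp only [ceBracketSum_succ, map_bracketSum]

theorem ceDifferential_comp {L M W : Type u} [LieRing L] [LieAlgebra ℝ L] [LieRing M]
    [LieAlgebra ℝ M] [AddCommGroup W] [Module ℝ W] {n : ℕ} (σ : M →ₗ⁅ℝ⁆ Module.End ℝ W)
    (φ : L →ₗ⁅ℝ⁆ M) (f : (Fin n → M) → W) :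
    ceDifferential (σ.comp φ) n (fun x ↦ f (φ ∘ x)) = fun x ↦ ceDifferential σ n f (φ ∘ x) := by
  funext x
  simp only [ceDifferential_apply, Pi.add_apply]
  refine congrArg₂ (· + ·) rfl ?_
  cases n with
  | zero => rfl
  | succ n =>
    simp only [ceBracketSum_succ, bracketSum]
    refine Finset.sum_congr rfl fun i _ ↦ Finset.sum_congr rfl fun j _ ↦ ?_
    split_ifs with h
    · refine congrArg (_ • f ·) (funext fun k ↦ ?_)
      refine Fin.cases ?_ (fun k ↦ ?_) k
      · simp
      · simp [Fin.removeNth_apply]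
    · rfl

theorem comp_mem_ceCochains {L M W : Type u} [LieRing L] [LieAlgebra ℝ L] [LieRing M]
    [LieAlgebra ℝ M] [AddCommGroup W] [Module ℝ W] {n : ℕ} (φ : L →ₗ⁅ℝ⁆ M)
    {f : (Fin n → M) → W} (hf : f ∈ ceCochains M W n) :
    (fun x ↦ f (φ ∘ x)) ∈ ceCochains L W n := by
  obtain ⟨a, rfl⟩ := hf
  exact ⟨a.compLinearMap φ.toLinearMap, rfl⟩

theorem const_mem_differentiableCochains (v : V) :
    (fun _ ↦ v) ∈ differentiableCochains E G V 0 :=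
  ⟨contMDiff_const, fun _ ⟨i, _⟩ ↦ i.elim0⟩

theorem isCochainComplex_mla {L M V W : Type u} [LieRing L] [LieAlgebra ℝ L] [LieRing M]
    [LieAlgebra ℝ M] [AddCommGroup V] [Module ℝ V] [AddCommGroup W] [Module ℝ W]
    (φ : L →ₗ⁅ℝ⁆ M) (ρV : L →ₗ⁅ℝ⁆ Module.End ℝ V) (ρW : M →ₗ⁅ℝ⁆ Module.End ℝ W)
    (ψ : V →ₗ[ℝ] W) (hψ : ∀ x v, ψ (ρV x v) = ρW (φ x) (ψ v)) :
    IsCochainComplex (mlaCochains L M V W) (mlaDifferential φ ρV ρW ψ) :=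
  isCochainComplex_morphism (isCochainComplex_ceCochains ρV) (isCochainComplex_ceCochains ρW)
    (isCochainComplex_ceCochains (ρW.comp φ)) const_mem_ceCochains const_mem_ceCochains
    (fun _ _ hf ↦ map_comp_mem_ceCochains ψ hf) (fun _ _ hf ↦ comp_mem_ceCochains φ hf)
    (fun _ f _ ↦ ceDifferential_map ρV (ρW.comp φ) ψ hψ f) (fun _ f _ ↦ ceDifferential_comp ρW φ f)

theorem isCochainComplex_mlg (Φ : ContMDiffMonoidMorphism 𝓘(ℝ, E) 𝓘(ℝ, F) ∞ G H)
    (ϱV : ContMDiffMonoidMorphism 𝓘(ℝ, E) 𝓘(ℝ, V →L[ℝ] V) ∞ G (V →L[ℝ] V)ˣ)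
    (ϱW : ContMDiffMonoidMorphism 𝓘(ℝ, F) 𝓘(ℝ, W →L[ℝ] W) ∞ H (W →L[ℝ] W)ˣ)
    (ψ : V →ₗ[ℝ] W)
    (hψ : ∀ (g : G) (v : V), ψ ((ϱV g : V →L[ℝ] V) v) = (ϱW (Φ g) : W →L[ℝ] W) (ψ v)) :
    IsCochainComplex (mlgCochains E F G H V W) (mlgDifferential Φ ϱV ϱW ψ) := by
  refine isCochainComplex_morphism (isCochainComplex_differentiableCochains ϱV)
    (isCochainComplex_differentiableCochains ϱW)
    (isCochainComplex_differentiableCochains (pullbackRep Φ ϱW))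
    const_mem_differentiableCochains const_mem_differentiableCochains
    (fun n f hf ↦ ⟨clm_comp_mem_smoothCochains (LinearMap.toContinuousLinearMap ψ) hf.1,
      fun g hg ↦ (congrArg ψ (hf.2 g hg)).trans (map_zero ψ)⟩)
    (fun n f hf ↦ ⟨comp_mem_smoothCochains Φ hf.1, fun g ⟨i, hi⟩ ↦ hf.2 _ ⟨i, ?_⟩⟩)
    (fun n f _ ↦ groupDifferential_map (groupRep ϱV) (groupRep (pullbackRep Φ ϱW)) ψ hψ f)
    (fun n f _ ↦ groupDifferential_comp (groupRep ϱW) Φ.toMonoidHom f)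
  rw [Function.comp_apply, hi]
  exact map_one Φ

theorem vanEst_groupDifferential_const
    (ϱ : ContMDiffMonoidMorphism 𝓘(ℝ, E) 𝓘(ℝ, V →L[ℝ] V) ∞ G (V →L[ℝ] V)ˣ) (v : V) :
    vanEst 1 (groupDifferential (groupRep ϱ) 0 (fun _ ↦ v)) =
      ceDifferential (lieRep ϱ) 0 (fun _ ↦ v) := by
  have h := vanEst_groupDifferential ϱ (const_mem_differentiableCochains (E := E) (G := G) v).1
  rwa [vanEst_zero] at h

theorem isCochainMap_morphismVanEst (Φ : ContMDiffMonoidMorphism 𝓘(ℝ, E) 𝓘(ℝ, F) ∞ G H)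
    (ϱV : ContMDiffMonoidMorphism 𝓘(ℝ, E) 𝓘(ℝ, V →L[ℝ] V) ∞ G (V →L[ℝ] V)ˣ)
    (ϱW : ContMDiffMonoidMorphism 𝓘(ℝ, F) 𝓘(ℝ, W →L[ℝ] W) ∞ H (W →L[ℝ] W)ˣ)
    (ψ : V →ₗ[ℝ] W) :
    IsCochainMap (mlgCochains E F G H V W) (mlgDifferential Φ ϱV ϱW ψ)
      (mlaCochains (GroupLieAlgebra 𝓘(ℝ, E) G) (GroupLieAlgebra 𝓘(ℝ, F) H) V W)
      (mlaDifferential (lieHom Φ) (lieRep ϱV) (lieRep ϱW) ψ)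
      (morphismVanEst E F G H V W) where
  map_mem n c hc := by
    cases n with
    | zero => exact (fun _ ↦ Submodule.mem_top : ∀ v : V, v ∈ (⊤ : Submodule ℝ V)) c
    | succ n =>
      exact ⟨vanEst_mem_ceCochains hc.1.1, vanEst_mem_ceCochains hc.2.1.1,
        vanEst_mem_ceCochains hc.2.2.1⟩
  map_add n c hc e he := by
    cases n with
    | zero => rfl
    | succ n =>
      exact Prod.ext (vanEst_add hc.1.1 he.1.1)
        (Prod.ext (vanEst_add hc.2.1.1 he.2.1.1) (vanEst_add hc.2.2.1 he.2.2.1))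
  map_smul n r c hc := by
    cases n with
    | zero => rfl
    | succ n =>
      exact Prod.ext (vanEst_smul r hc.1.1)
        (Prod.ext (vanEst_smul r hc.2.1.1) (vanEst_smul r hc.2.2.1))
  comm n c hc := by
    cases n with
    | zero =>
      exact Prod.ext (vanEst_groupDifferential_const ϱV c)
        (Prod.ext (vanEst_groupDifferential_const ϱW (ψ c)) (vanEst_zero 0))
    | succ n =>
      obtain ⟨a, b, e⟩ := c
      obtain ⟨ha, hb, he⟩ := hc
      refine Prod.ext (vanEst_groupDifferential ϱV ha.1)
        (Prod.ext (vanEst_groupDifferential ϱW hb.1) ?_)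
      -- The action of `G` on `W` through Φ is definitionally `groupRep (pullbackRep Φ ϱW)`, which
      -- makes `vanEst_groupDifferential` applicable to the third component.
      change vanEst (n + 1) ((fun x ↦ ψ (a x)) - (fun x ↦ b (Φ ∘ x)) -
        groupDifferential (groupRep (pullbackRep Φ ϱW)) n e) =
        (fun x ↦ ψ (vanEst (n + 1) a x)) - (fun x ↦ vanEst (n + 1) b (lieHom Φ ∘ x)) -
          ceDifferential ((lieRep ϱW).comp (lieHom Φ)) n (vanEst n e)
      have m1 : (fun x ↦ ψ (a x)) ∈ smoothCochains E G W (n + 1) :=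
        clm_comp_mem_smoothCochains (LinearMap.toContinuousLinearMap ψ) ha.1
      have m2 := comp_mem_smoothCochains Φ hb.1
      have m3 := groupDifferential_mem_smoothCochains (pullbackRep Φ ϱW) he.1
      have e1 : vanEst (E := E) (n + 1) (fun x ↦ ψ (a x)) = fun x ↦ ψ (vanEst (n + 1) a x) :=
        vanEst_clm (LinearMap.toContinuousLinearMap ψ) ha.1
      rw [vanEst_sub (Submodule.sub_mem _ m1 m2) m3, vanEst_sub m1 m2, e1, vanEst_comp Φ hb.1,
        vanEst_groupDifferential (pullbackRep Φ ϱW) he.1, lieRep_pullbackRep]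

/-- Differentiate the equivariance of ψ at g = 1; ψ commutes with the derivative since it is
continuous linear. -/
theorem lieRep_equivariant (Φ : ContMDiffMonoidMorphism 𝓘(ℝ, E) 𝓘(ℝ, F) ∞ G H)
    (ϱV : ContMDiffMonoidMorphism 𝓘(ℝ, E) 𝓘(ℝ, V →L[ℝ] V) ∞ G (V →L[ℝ] V)ˣ)
    (ϱW : ContMDiffMonoidMorphism 𝓘(ℝ, F) 𝓘(ℝ, W →L[ℝ] W) ∞ H (W →L[ℝ] W)ˣ)
    (ψ : V →ₗ[ℝ] W)
    (hψ : ∀ (g : G) (v : V), ψ ((ϱV g : V →L[ℝ] V) v) = (ϱW (Φ g) : W →L[ℝ] W) (ψ v))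
    (X : GroupLieAlgebra 𝓘(ℝ, E) G) (v : V) :
    ψ (lieRep ϱV X v) = lieRep ϱW (lieHom Φ X) (ψ v) := by
  have h1 : lieRep ϱW (lieHom Φ X) = lieRep (pullbackRep Φ ϱW) X := by
    rw [lieRep_pullbackRep]; rfl
  rw [h1, ← dirDeriv_rep, ← dirDeriv_rep]
  refine (dirDeriv_clm (LinearMap.toContinuousLinearMap ψ) (mdifferentiableAt_rep ϱV v 1) X).symm.trans
    ?_
  exact congrArg (fun k ↦ dirDeriv k (1 : G) X) (funext fun g ↦ hψ g v)

end MorphismLieGroup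

theorem mainTheorem8 {E F G H V W : Type u}
    [NormedAddCommGroup E] [NormedSpace ℝ E] [FiniteDimensional ℝ E]
    [NormedAddCommGroup F] [NormedSpace ℝ F] [FiniteDimensional ℝ F]
    [TopologicalSpace G] [ChartedSpace E G] [Group G] [LieGroup 𝓘(ℝ, E) ∞ G]
    [TopologicalSpace H] [ChartedSpace F H] [Group H] [LieGroup 𝓘(ℝ, F) ∞ H]
    [NormedAddCommGroup V] [NormedSpace ℝ V] [FiniteDimensional ℝ V]
    [NormedAddCommGroup W] [NormedSpace ℝ W] [FiniteDimensional ℝ W]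
    (Φ : ContMDiffMonoidMorphism 𝓘(ℝ, E) 𝓘(ℝ, F) ∞ G H)
    (ϱV : ContMDiffMonoidMorphism 𝓘(ℝ, E) 𝓘(ℝ, V →L[ℝ] V) ∞ G (V →L[ℝ] V)ˣ)
    (ϱW : ContMDiffMonoidMorphism 𝓘(ℝ, F) 𝓘(ℝ, W →L[ℝ] W) ∞ H (W →L[ℝ] W)ˣ)
    (ψ : V →ₗ[ℝ] W)
    (hψ : ∀ (g : G) (v : V), ψ ((ϱV g : V →L[ℝ] V) v) = (ϱW (Φ g) : W →L[ℝ] W) (ψ v)) :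
    (∀ (X : GroupLieAlgebra 𝓘(ℝ, E) G) (v : V),
      ψ (lieRep ϱV X v) = lieRep ϱW (lieHom Φ X) (ψ v)) ∧
    IsCochainComplex (mlgCochains E F G H V W) (mlgDifferential Φ ϱV ϱW ψ) ∧
    IsCochainComplex
      (mlaCochains (GroupLieAlgebra 𝓘(ℝ, E) G) (GroupLieAlgebra 𝓘(ℝ, F) H) V W)
      (mlaDifferential (lieHom Φ) (lieRep ϱV) (lieRep ϱW) ψ) ∧
    IsCochainMap (mlgCochains E F G H V W) (mlgDifferential Φ ϱV ϱW ψ)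
      (mlaCochains (GroupLieAlgebra 𝓘(ℝ, E) G) (GroupLieAlgebra 𝓘(ℝ, F) H) V W)
      (mlaDifferential (lieHom Φ) (lieRep ϱV) (lieRep ϱW) ψ)
      (morphismVanEst E F G H V W) ∧
    ∃ vEH : ∀ n, Cohomology (mlgCochains E F G H V W) (mlgDifferential Φ ϱV ϱW ψ) n →ₗ[ℝ]
        Cohomology (mlaCochains (GroupLieAlgebra 𝓘(ℝ, E) G) (GroupLieAlgebra 𝓘(ℝ, F) H) V W)
          (mlaDifferential (lieHom Φ) (lieRep ϱV) (lieRep ϱW) ψ) n,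
      ∀ n (z : cocycles (mlgCochains E F G H V W) (mlgDifferential Φ ϱV ϱW ψ) n),
        ∃ w : cocycles
            (mlaCochains (GroupLieAlgebra 𝓘(ℝ, E) G) (GroupLieAlgebra 𝓘(ℝ, F) H) V W)
            (mlaDifferential (lieHom Φ) (lieRep ϱV) (lieRep ϱW) ψ) n,
          w.1 = morphismVanEst E F G H V W n z.1 ∧
            vEH n (cohomologyClass _ _ n z) = cohomologyClass _ _ n w :=
  have h := lieRep_equivariant Φ ϱV ϱW ψ hψ
  have hF := isCochainMap_morphismVanEst Φ ϱV ϱW ψ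
  ⟨h, isCochainComplex_mlg Φ ϱV ϱW ψ hψ, isCochainComplex_mla (lieHom Φ) _ _ ψ h, hF,
    hF.exists_cohomologyMap⟩
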